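/- For each $n\ge 1$ let $X_1,\dots,X_n$ be independent random variables with $X_i\sim N(\theta_i,1)$ under $P_{\boldsymbol\theta}$, where $\boldsymbol\theta=\boldsymbol\theta_n\in\mathbb R^n$ is an unknown vector that may vary with $n$; write $\boldsymbol X=(X_1,\dots,X_n)$. For $\lambda\ge 0$ let $s_\lambda(x)=\mathrm{sgn}(x)\,(|x|-\lambda)_+$, applied to vectors componentwise. Fix constants $0<\alpha_2\le\alpha_1<1$, let $\Phi$ be the standard normal distribution function, and put $$\xi_{j,k}=-\Phi^{-1}\Big(\frac{\alpha_j k}{2n}\Big),\qquad N(t)=\#\{i\le n: |X_i|\ge t\},$$ $$\hat\xi_1=\min\{\xi_{1,k}: 1\le k\le n,\ N(\xi_{1,k})\ge k\},\qquad \hat\xi_2=\max\{\xi_{2,k}: 1\le k\le n,\ N(\xi_{2,k+1})<k+1\},$$ where $\hat\xi_1=\xi_{1,1}$ if the set defining $\hat\xi_1$ is empty. Let $0\le\delta_{1,n}\le\delta_{2,n}\to 0$, and let $\hat\lambda=\hat\lambda_n$ be a random threshold level satisfying $$\sqrt{1+\delta_{1,n}}\;\hat\xi_1\le\hat\lambda\le\sqrt{1+\delta_{2,n}}\;\hat\xi_2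 .$$ Define $$L_{0,n}=(\log n)^{-3/2}\Big(\delta_{1,n}(\log n)^{3/2}+(\log\log n)\sqrt{\log n}\Big)^{1+\delta_{1,n}} .$$ Suppose that, as $n\to\infty$, $$\frac{L_{0,n}}{n^{\delta_{1,n}}}=o\Big(\inf_{\lambda\ge 0}E_{\boldsymbol\theta}\|s_\lambda(\boldsymbol X)-\boldsymbol\theta\|^2\Big)\quad\text{and}\quad \inf_{\lambda\ge 0}E_{\boldsymbol\theta}\|s_\lambda(\boldsymbol X)-\boldsymbol\theta\|^2=o(n).$$ Then $E_{\boldsymbol\theta}\|s_{\hat\lambda}(\boldsymbol X)-\boldsymbol\theta\|^2<\infty$ for every $n\ge1$, and $$\limsup_{n\to\infty}\frac{E_{\boldsymbol\theta}\|s_{\hat\lambda}(\boldsymbol X)-\boldsymbol\theta\|^2}{\inf_{\lambda\ge 0}E_{\boldsymbol\theta}\|s_\lambda(\boldsymbol X)-\boldsymbol\theta\|^2}\le 1 .$$ -/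

import Mathlib

open MeasureTheory ProbabilityTheory Filter Topology Asymptotics

noncomputable section

namespace FDR

/-- The standard normal quantile function `Φ⁻¹(p)`, `0 < p < 1`. -/
def stdNormalQuantile (p : ℝ) : ℝ :=
  sInf {x : ℝ | p ≤ cdf (gaussianReal 0 1) x}

/-- The candidate threshold level `ξ_k = -Φ⁻¹(α k / (2 n))`. -/
def xi (α : ℝ) (n k : ℕ) : ℝ :=
  -stdNormalQuantile (α * (k : ℝ) / (2 * (n : ℝ)))

/-- `N(t)`, the number of observations with `|x_i| ≥ t`. -/
def count {n : ℕ} (x : Fin n → ℝ) (t : ℝ) : ℕ :=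
  (Finset.univ.filter fun i : Fin n => t ≤ |x i|).card

/-- The levels `ξ_k`, `1 ≤ k ≤ n`, with `N(ξ_k) ≥ k`. -/
def stepUpSet (α : ℝ) {n : ℕ} (x : Fin n → ℝ) : Set ℝ :=
  {t | ∃ k : ℕ, 1 ≤ k ∧ k ≤ n ∧ k ≤ count x (xi α n k) ∧ t = xi α n k}

open Classical in
/-- The Benjamini-Hochberg (step-up) threshold `min {ξ_k : N(ξ_k) ≥ k}`. When no hypothesis is
rejected (the set is empty) it is the highest candidate level `ξ_1`. -/
def xiHatUp (α : ℝ) {n : ℕ} (x : Fin n → ℝ) : ℝ :=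
  if (stepUpSet α x).Nonempty then sInf (stepUpSet α x) else xi α n 1

/-- The levels `ξ_k`, `1 ≤ k ≤ n`, with `N(ξ_{k+1}) < k + 1`. For `n ≥ 1` and `0 < α < 1` the
index `k = n` always qualifies, so this finite set is nonempty. -/
def stepDownSet (α : ℝ) {n : ℕ} (x : Fin n → ℝ) : Set ℝ :=
  {t | ∃ k : ℕ, 1 ≤ k ∧ k ≤ n ∧ count x (xi α n (k + 1)) < k + 1 ∧ t = xi α n k}

/-- The step-down threshold `max {ξ_k : N(ξ_{k+1}) < k + 1}`. -/
def xiHatDown (α : ℝ) {n : ℕ} (x : Fin n → ℝ) : ℝ :=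
  sSup (stepDownSet α x)

/-- The soft threshold function `s_l(x) = sgn(x) (|x| - l)_+`. -/
def soft (l x : ℝ) : ℝ :=
  Real.sign x * max (|x| - l) 0

/-- The squared error loss `‖s_l(x) - θ‖²`. -/
def loss {n : ℕ} (θ : Fin n → ℝ) (l : ℝ) (x : Fin n → ℝ) : ℝ :=
  ∑ i, (soft l (x i) - θ i) ^ 2

/-- The risk `E ‖s_l(X) - θ‖²` at a possibly random threshold level `l`. -/
def risk {n : ℕ} {Ω : Type*} [MeasurableSpace Ω] (P : Measure Ω) (X : Fin n → Ω → ℝ)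
    (θ : Fin n → ℝ) (l : Ω → ℝ) : ℝ :=
  ∫ ω, loss θ (l ω) (fun i => X i ω) ∂P

/-- The minimal risk `inf_{l ≥ 0} E ‖s_l(X) - θ‖²` over deterministic threshold levels. -/
def minRisk {n : ℕ} {Ω : Type*} [MeasurableSpace Ω] (P : Measure Ω) (X : Fin n → Ω → ℝ)
    (θ : Fin n → ℝ) : ℝ :=
  ⨅ l : Set.Ici (0 : ℝ), risk P X θ (fun _ => (l : ℝ))

/-- `L_{0,n} = (log n)^{-3/2} (δ (log n)^{3/2} + (log log n) √(log n))^{1+δ}`. -/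
def L0 (δ : ℝ) (n : ℕ) : ℝ :=
  Real.log n ^ (-(3 / 2) : ℝ) *
    (δ * Real.log n ^ (3 / 2 : ℝ) + Real.log (Real.log n) * Real.sqrt (Real.log n)) ^ (1 + δ)

end FDR

end

namespace FDR

/-! Choose for each $n$ a deterministic level $L$ whose risk $R$ is within a factor $1+\varepsilon$
of the infimum. Since $R=o(n)$ and $R\ge n\,E\,s_L(Z)^2/2$ for $Z\sim N(0,1)$, the level $L$ tends
to infinity, and then $R$ is bounded below in two ways: by almost $M=\sum_i\min(|\theta_i|,L)^2$
(`exists_le_coordRisk`) and by half the noise passing $L$ (`noiseRisk_le_coordRisk`). The loss at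
$\hat\lambda$ is dominated pathwise by $1+\varepsilon$ times a truncated signal, plus a multiple of
the thresholded noise and of the noise at the few large signals (`loss_le`). It remains to show that
the first costs asymptotically no more than $M$ and that the rest is negligible against $R$.

Bias. If many signals exceed $t$, then at every candidate level above $t$ far more exceedances are
expected than the step-down rule tolerates, so that rule stops above $t$ with exponentially small
probability. Hence the number of signals above $t$ times this probability is of the order of the
null count $n(1-\Phi(t))$ (`card_mul_measureReal_lt_xiHatDown_le`). Summing over unit layers above
$(1+\varepsilon)L$ (`integral_sum_min_sq_le`) leaves about $nL\exp(-(1+\varepsilon)L^2/2)$, which is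
far below the noise passing $L$.

Noise. A signal raises the exceedance probability of a high level only by a small fraction of
$\min(|\theta_i|,L)^2$ (`exists_exceedance_sub_le_small`). So beyond an index $m$ of order
$\delta_1\log n+\log\log n$ plus a small multiple of $M$, fewer than $ak$ exceedances of $\xi_k$ are
expected, with $a<1$, and by a Chernoff bound the step-up rule rarely descends there
(`integral_sum_soft_noise_sq_le`). The noise passing $\sqrt{1+\delta_1}\,\xi_m$ is bounded by a
multiple of $L_0/n^{\delta_1}$ or by a small multiple of $M$, according to which term determines
$m$. This is where the lower bound on the minimal risk enters. -/

/-- The standard normal distribution. -/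
noncomputable abbrev stdGaussian : Measure ℝ := gaussianReal 0 1

/-- The upper tail `1 - Φ(t)` of the standard normal distribution. -/
noncomputable def gaussianTail (t : ℝ) : ℝ := stdGaussian.real (Set.Ioi t)

/-- The risk of soft thresholding at level `l` of pure noise. -/
noncomputable def noiseRisk (l : ℝ) : ℝ := ∫ z, soft l z ^ 2 ∂stdGaussian

/-! ### Gaussian shifts and the normal tail -/

lemma integral_stdGaussian (f : ℝ → ℝ) :
    ∫ z, f z ∂stdGaussian = ∫ z, gaussianPDFReal 0 1 z * f z := by
  rw [integral_gaussianReal_eq_integral_smul one_ne_zero]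
  rfl

/-- Cameron-Martin formula on the line. -/
lemma integral_stdGaussian_shift (f : ℝ → ℝ) (θ : ℝ) :
    ∫ z, f (θ + z) ∂stdGaussian
      = ∫ z, f z * Real.exp (θ * z - θ ^ 2 / 2) ∂stdGaussian := by
  rw [integral_stdGaussian, integral_stdGaussian,
    ← integral_sub_right_eq_self (fun z => gaussianPDFReal 0 1 z * f (θ + z)) θ]
  congr 1
  ext z
  have h : gaussianPDFReal 0 1 (z - θ)
      = gaussianPDFReal 0 1 z * Real.exp (θ * z - θ ^ 2 / 2) := by
    simp only [gaussianPDFReal, mul_assoc, ← Real.exp_add]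
    congr 2
    simp
    ring
  rw [h]
  ring_nf

lemma integral_stdGaussian_neg (f : ℝ → ℝ) :
    ∫ z, f (-z) ∂stdGaussian = ∫ z, f z ∂stdGaussian := by
  rw [integral_stdGaussian, integral_stdGaussian,
    ← integral_neg_eq_self (fun z => gaussianPDFReal 0 1 z * f z)]
  congr 1
  ext z
  simp [gaussianPDFReal]

lemma integrable_sq_mul_exp_abs (a : ℝ) :
    Integrable (fun z => z ^ 2 * Real.exp (a * |z|)) stdGaussian := by
  have h := integrable_exp_mul_abs (X := fun z : ℝ => z) (μ := stdGaussian) (t := a + 1)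
    (integrable_exp_mul_gaussianReal _) (integrable_exp_mul_gaussianReal _)
  refine (h.const_mul 2).mono' (by fun_prop) (ae_of_all _ fun z => ?_)
  rw [Real.norm_of_nonneg (by positivity), add_mul, Real.exp_add, one_mul]
  have h1 := Real.quadratic_le_exp_of_nonneg (abs_nonneg z)
  have h2 : z ^ 2 ≤ 2 * Real.exp |z| := by
    rw [← sq_abs]; nlinarith [abs_nonneg z]
  nlinarith [Real.exp_pos (a * |z|)]

lemma integrable_sq_stdGaussian : Integrable (fun z => z ^ 2) stdGaussian := by
  simpa using integrable_sq_mul_exp_abs 0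

lemma integral_sq_stdGaussian : ∫ z, z ^ 2 ∂stdGaussian = 1 := by
  have h := variance_fun_id_gaussianReal (μ := 0) (v := 1)
  rw [variance_eq_integral (by fun_prop)] at h
  simpa using h

lemma gaussianTail_eq_integral (t : ℝ) :
    gaussianTail t = ∫ z, (Set.Ioi t).indicator 1 z ∂stdGaussian := by
  rw [integral_indicator_one measurableSet_Ioi, gaussianTail]

/-- Translation by `t` becomes an exponential tilt, so that the tail bounds below reduce to
monotonicity of the tilt. -/
lemma gaussianTail_add (t u : ℝ) :
    gaussianTail (t + u)
      = ∫ z in Set.Ioi u, Real.exp (-t * z - t ^ 2 / 2) ∂stdGaussian := by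
  have h := integral_stdGaussian_shift ((Set.Ioi u).indicator 1) (-t)
  rw [gaussianTail_eq_integral, ← integral_indicator measurableSet_Ioi]
  convert h using 2
  · ext z
    simp only [Set.indicator_apply, Set.mem_Ioi]
    congr 1
    exact propext ⟨fun h => by linarith, fun h => by linarith⟩
  · ext z
    simp [Set.indicator_apply]

lemma gaussianTail_nonneg (t : ℝ) : 0 ≤ gaussianTail t := measureReal_nonneg

lemma gaussianTail_le_one (t : ℝ) : gaussianTail t ≤ 1 := measureReal_le_one

lemma measureReal_Ici_stdGaussian (t : ℝ) : stdGaussian.real (Set.Ici t) = gaussianTail t := by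
  have := nullSingletonClass_gaussianReal (μ := 0) (one_ne_zero (α := NNReal))
  exact measureReal_congr Ioi_ae_eq_Ici.symm

lemma measureReal_Iic_neg_stdGaussian (t : ℝ) :
    stdGaussian.real (Set.Iic (-t)) = gaussianTail t := by
  rw [← measureReal_Ici_stdGaussian, ← integral_indicator_one measurableSet_Iic,
    ← integral_indicator_one measurableSet_Ici, ← integral_stdGaussian_neg]
  congr 1
  ext z
  simp [Set.indicator_apply]

lemma gaussianTail_zero : gaussianTail 0 = 1 / 2 := by
  have h1 := measureReal_Iic_neg_stdGaussian 0
  have h2 := probReal_compl_eq_one_sub (μ := stdGaussian) (measurableSet_Iic (a := (0 : ℝ)))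
  rw [Set.compl_Iic] at h2
  rw [neg_zero] at h1
  unfold gaussianTail at *
  linarith

lemma gaussianTail_antitone : Antitone gaussianTail :=
  fun _ _ h => measureReal_mono (Set.Ioi_subset_Ioi h)

lemma measure_Ioc_stdGaussian_pos {s t : ℝ} (h : s < t) : 0 < stdGaussian.real (Set.Ioc s t) := by
  rw [measureReal_def, ENNReal.toReal_pos_iff]
  refine ⟨?_, measure_lt_top _ _⟩
  have h1 : (volume : Measure ℝ) ≪ stdGaussian := gaussianReal_absolutelyContinuous' 0 one_ne_zero
  rw [pos_iff_ne_zero]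
  intro h0
  have := h1 h0
  rw [Real.volume_Ioc, ENNReal.ofReal_eq_zero] at this
  linarith

lemma gaussianTail_sub {s t : ℝ} (h : s ≤ t) :
    gaussianTail s = stdGaussian.real (Set.Ioc s t) + gaussianTail t := by
  rw [gaussianTail, gaussianTail, ← measureReal_union _ measurableSet_Ioi,
    Set.Ioc_union_Ioi_eq_Ioi h]
  exact Set.disjoint_left.2 fun x hx hx' => absurd hx.2 (not_le.2 hx')

lemma gaussianTail_strictAnti : StrictAnti gaussianTail := fun s t h => by
  rw [gaussianTail_sub h.le]
  linarith [measure_Ioc_stdGaussian_pos h]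

lemma gaussianTail_pos (t : ℝ) : 0 < gaussianTail t :=
  (gaussianTail_nonneg (t + 1)).trans_lt (gaussianTail_strictAnti (lt_add_one t))

lemma integrable_exp_linear (t c : ℝ) :
    Integrable (fun z => Real.exp (t * z - c)) stdGaussian := by
  simp_rw [Real.exp_sub]
  exact (integrable_exp_mul_gaussianReal t).div_const _

lemma gaussianTail_le_exp {t : ℝ} (ht : 0 ≤ t) : gaussianTail t ≤ Real.exp (-t ^ 2 / 2) := by
  have h := gaussianTail_add t 0
  rw [add_zero] at h
  rw [h]
  calc ∫ z in Set.Ioi 0, Real.exp (-t * z - t ^ 2 / 2) ∂stdGaussian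
      ≤ ∫ z in Set.Ioi (0 : ℝ), Real.exp (-t ^ 2 / 2) ∂stdGaussian := by
        refine setIntegral_mono_on (integrable_exp_linear _ _).integrableOn
          (integrable_const _).integrableOn measurableSet_Ioi fun z hz => Real.exp_le_exp.2 ?_
        have : 0 ≤ t * z := mul_nonneg ht (le_of_lt hz)
        linarith
    _ = gaussianTail 0 * Real.exp (-t ^ 2 / 2) := by
        rw [setIntegral_const, smul_eq_mul, gaussianTail]
    _ ≤ _ := by
        have := gaussianTail_le_one 0
        nlinarith [Real.exp_pos (-t ^ 2 / 2)]

/-- Submultiplicativity of the normalized normal tail. -/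
lemma gaussianTail_add_le {t u : ℝ} (ht : 0 ≤ t) (hu : 0 ≤ u) :
    gaussianTail (t + u) ≤ 2 * gaussianTail t * gaussianTail u := by
  -- The tilt decreases, so its mean over `(u, ∞)` is at most `g u`, hence at most its mean over
  -- `(0, u]`. The factor 2 normalizes the half line, which has mass `1 / 2`.
  set g : ℝ → ℝ := fun z => Real.exp (-t * z - t ^ 2 / 2) with hg
  have hgi : Integrable g stdGaussian := integrable_exp_linear _ _
  have hgmono : Antitone g := fun x y hxy => Real.exp_le_exp.2 (by nlinarith)
  have hA := gaussianTail_add t u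
  have hT := gaussianTail_add t 0
  rw [add_zero] at hT
  have hsplit : Set.Ioi (0 : ℝ) = Set.Ioc 0 u ∪ Set.Ioi u := (Set.Ioc_union_Ioi_eq_Ioi hu).symm
  have hdisj : Disjoint (Set.Ioc 0 u) (Set.Ioi u) :=
    Set.disjoint_left.2 fun x hx hx' => absurd hx.2 (not_le.2 hx')
  rw [hsplit, setIntegral_union hdisj measurableSet_Ioi hgi.integrableOn hgi.integrableOn,
    ← hA] at hT
  have h1 : gaussianTail (t + u) ≤ g u * gaussianTail u := by
    rw [hA]
    calc ∫ z in Set.Ioi u, g z ∂stdGaussian ≤ ∫ z in Set.Ioi u, g u ∂stdGaussian :=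
          setIntegral_mono_on hgi.integrableOn (integrable_const _).integrableOn measurableSet_Ioi
            fun z hz => hgmono (le_of_lt hz)
      _ = _ := by rw [setIntegral_const, smul_eq_mul, mul_comm]; rfl
  have h2 : g u * (1 / 2 - gaussianTail u) ≤ ∫ z in Set.Ioc 0 u, g z ∂stdGaussian := by
    have h3 := gaussianTail_sub hu
    rw [gaussianTail_zero] at h3
    calc g u * (1 / 2 - gaussianTail u) = ∫ z in Set.Ioc 0 u, g u ∂stdGaussian := by
          rw [setIntegral_const, smul_eq_mul, mul_comm, h3]; ring
      _ ≤ _ := setIntegral_mono_on (integrable_const _).integrableOn hgi.integrableOn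
          measurableSet_Ioc fun z hz => hgmono hz.2
  have h4 : gaussianTail u ≤ 1 / 2 := gaussianTail_zero ▸ gaussianTail_antitone hu
  have h5 := gaussianTail_nonneg u
  nlinarith [mul_le_mul_of_nonneg_right h1 (sub_nonneg.2 h4), mul_le_mul_of_nonneg_right h2 h5]

/-- A Mills ratio bound: on `(0, 1/t]` the tilt `exp (-t z)` stays above `exp (-1)`, and this
interval has mass at least `c / t`, where `c` is the density at 1. -/
lemma exp_le_mul_gaussianTail :
    ∃ C : ℝ, 0 < C ∧ ∀ t : ℝ, 1 ≤ t → Real.exp (-t ^ 2 / 2) ≤ C * t * gaussianTail t := by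
  set c := gaussianPDFReal 0 1 1 with hc
  have hcpos : 0 < c := gaussianPDFReal_pos _ _ _ one_ne_zero
  refine ⟨Real.exp 1 / c, by positivity, fun t ht => ?_⟩
  have ht0 : 0 < t := by linarith
  have hmass : c / t ≤ stdGaussian.real (Set.Ioc 0 (1 / t)) := by
    have h := integral_stdGaussian ((Set.Ioc 0 (1 / t)).indicator 1)
    rw [integral_indicator_one measurableSet_Ioc] at h
    have h' : ∀ z, gaussianPDFReal 0 1 z * (Set.Ioc 0 (1 / t)).indicator 1 z
        = (Set.Ioc 0 (1 / t)).indicator (gaussianPDFReal 0 1) z := fun z => by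
      simp [Set.indicator_apply]
    simp_rw [h'] at h
    rw [h, integral_indicator measurableSet_Ioc]
    calc c / t = ∫ z in Set.Ioc 0 (1 / t), c := by
          rw [setIntegral_const]
          simp [ht0.le, measureReal_def, Real.volume_Ioc]
          field_simp
      _ ≤ _ := by
          refine setIntegral_mono_on (integrableOn_const (by simp))
            (integrable_gaussianPDFReal _ _).integrableOn measurableSet_Ioc fun z hz => ?_
          have : 1 / t ≤ 1 := by rw [div_le_one ht0]; exact ht
          have hz1 : z ≤ 1 := hz.2.trans this
          simp only [hc, gaussianPDFReal]
          gcongr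
          simp only [sub_zero]
          nlinarith [hz.1]
  have h := gaussianTail_add t 0
  rw [add_zero] at h
  have h1 : Real.exp (-1 - t ^ 2 / 2) * (c / t) ≤ gaussianTail t := by
    rw [h]
    calc Real.exp (-1 - t ^ 2 / 2) * (c / t)
        ≤ Real.exp (-1 - t ^ 2 / 2) * stdGaussian.real (Set.Ioc 0 (1 / t)) := by gcongr
      _ = ∫ z in Set.Ioc 0 (1 / t), Real.exp (-1 - t ^ 2 / 2) ∂stdGaussian := by
          rw [setIntegral_const, smul_eq_mul, mul_comm]
      _ ≤ ∫ z in Set.Ioc 0 (1 / t), Real.exp (-t * z - t ^ 2 / 2) ∂stdGaussian := by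
          refine setIntegral_mono_on (integrable_const _).integrableOn
            (integrable_exp_linear _ _).integrableOn measurableSet_Ioc fun z hz => ?_
          have : t * z ≤ 1 := by
            have := hz.2
            rw [le_div_iff₀ ht0] at this
            linarith
          gcongr
          linarith
      _ ≤ _ := setIntegral_mono_set (integrable_exp_linear _ _).integrableOn
          (ae_of_all _ fun z => (Real.exp_pos _).le) Set.Ioc_subset_Ioi_self.eventuallyLE
  have h2 : Real.exp (-t ^ 2 / 2) = Real.exp 1 * Real.exp (-1 - t ^ 2 / 2) := by
    rw [← Real.exp_add]; ring_nf
  rw [h2]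
  calc Real.exp 1 * Real.exp (-1 - t ^ 2 / 2)
      = Real.exp 1 / c * t * (Real.exp (-1 - t ^ 2 / 2) * (c / t)) := by field_simp
    _ ≤ _ := by gcongr

/-! ### The quantile function -/

lemma cdf_stdGaussian (x : ℝ) : cdf stdGaussian x = gaussianTail (-x) := by
  rw [cdf_eq_real, ← measureReal_Iic_neg_stdGaussian, neg_neg]

lemma continuous_gaussianTail : Continuous gaussianTail := by
  have hint := integrable_gaussianPDFReal 0 1
  have h : ∀ t, gaussianTail t = gaussianTail 0 - ∫ z in (0 : ℝ)..t, gaussianPDFReal 0 1 z := by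
    have hI : ∀ t, gaussianTail t = ∫ z in Set.Ioi t, gaussianPDFReal 0 1 z := fun t => by
      rw [gaussianTail, measureReal_def, gaussianReal_apply_eq_integral _ one_ne_zero,
        ENNReal.toReal_ofReal (setIntegral_nonneg measurableSet_Ioi
          fun z _ => gaussianPDFReal_nonneg _ _ _)]
    intro t
    rw [hI, hI, ← intervalIntegral.integral_Ioi_sub_Ioi' hint.integrableOn hint.integrableOn]
    ring
  rw [funext h]
  exact continuous_const.sub (intervalIntegral.continuous_primitive
    (fun a b => hint.intervalIntegrable) 0)

lemma tendsto_gaussianTail_atTop : Tendsto gaussianTail atTop (𝓝 0) := by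
  have h := (tendsto_cdf_atBot stdGaussian).comp tendsto_neg_atTop_atBot
  refine h.congr fun t => ?_
  simp [cdf_stdGaussian]

lemma tendsto_gaussianTail_atBot : Tendsto gaussianTail atBot (𝓝 1) := by
  have h := (tendsto_cdf_atTop stdGaussian).comp tendsto_neg_atBot_atTop
  refine h.congr fun t => ?_
  simp [cdf_stdGaussian]

lemma gaussianTail_neg_stdNormalQuantile {p : ℝ} (h0 : 0 < p) (h1 : p < 1) :
    gaussianTail (-stdNormalQuantile p) = p := by
  obtain ⟨a, ha⟩ := (tendsto_gaussianTail_atTop.eventually_lt_const h0).exists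
  obtain ⟨b, hb⟩ := (tendsto_gaussianTail_atBot.eventually_const_lt h1).exists
  obtain ⟨x, hx⟩ := mem_range_of_exists_le_of_exists_ge continuous_gaussianTail
    ⟨a, ha.le⟩ ⟨b, hb.le⟩
  have hset : {y : ℝ | p ≤ cdf (gaussianReal 0 1) y} = Set.Ici (-x) := by
    ext y
    simp only [Set.mem_ofPred_eq, Set.mem_Ici, cdf_stdGaussian]
    rw [← hx, gaussianTail_strictAnti.le_iff_ge]
    exact neg_le
  rw [stdNormalQuantile, hset, csInf_Ici, neg_neg, hx]

lemma gaussianTail_xi {α : ℝ} {n k : ℕ} (h0 : 0 < α) (hk : 1 ≤ k) (hn : 1 ≤ n)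
    (h1 : α * k < 2 * n) : gaussianTail (xi α n k) = α * k / (2 * n) := by
  have hn' : (0 : ℝ) < n := by exact_mod_cast hn
  have hk' : (0 : ℝ) < k := by exact_mod_cast hk
  refine gaussianTail_neg_stdNormalQuantile (by positivity) ?_
  rw [div_lt_one (by positivity)]
  exact h1

lemma xi_nonneg {α : ℝ} {n k : ℕ} (h0 : 0 < α) (h1 : α < 1) (hk : 1 ≤ k) (hkn : k ≤ n) :
    0 ≤ xi α n k := by
  have hk' : (0 : ℝ) < k := by exact_mod_cast hk
  have hkn' : (k : ℝ) ≤ n := by exact_mod_cast hkn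
  have h : α * k < 2 * n := by nlinarith
  have h2 := gaussianTail_xi h0 hk (hk.trans hkn) h
  rw [← gaussianTail_strictAnti.le_iff_ge, h2, gaussianTail_zero,
    div_le_div_iff₀ (by linarith) (by norm_num)]
  nlinarith

lemma xi_le_xi {α : ℝ} {n k m : ℕ} (h0 : 0 < α) (hk : 1 ≤ k) (hkm : k ≤ m) (hn : 1 ≤ n)
    (hm : α * m < 2 * n) : xi α n m ≤ xi α n k := by
  have hkm' : (k : ℝ) ≤ m := by exact_mod_cast hkm
  have hk2 : α * k < 2 * n := (mul_le_mul_of_nonneg_left hkm' h0.le).trans_lt hm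
  rw [← gaussianTail_strictAnti.le_iff_ge, gaussianTail_xi h0 hk hn hk2,
    gaussianTail_xi h0 (hk.trans hkm) hn hm]
  gcongr

/-! ### The soft threshold function -/

/-- Positive parts replace the sign function, so that pathwise inequalities become linear case
checks. -/
lemma soft_eq {l : ℝ} (hl : 0 ≤ l) (x : ℝ) : soft l x = max (x - l) 0 - max (-x - l) 0 := by
  unfold soft
  rcases lt_trichotomy x 0 with h | h | h
  · rw [Real.sign_of_neg h, abs_of_neg h, max_eq_right (a := x - l) (by linarith)]; ring
  · subst h; simp
  · rw [Real.sign_of_pos h, abs_of_pos h, max_eq_right (a := -x - l) (by linarith)]; ring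

lemma soft_sq {l : ℝ} (hl : 0 ≤ l) (x : ℝ) :
    soft l x ^ 2 = max (x - l) 0 ^ 2 + max (-x - l) 0 ^ 2 := by
  rw [soft_eq hl]
  rcases le_total x 0 with h | h
  · rw [max_eq_right (a := x - l) (by linarith)]; ring
  · rw [max_eq_right (a := -x - l) (by linarith)]; ring

lemma soft_neg {l : ℝ} (hl : 0 ≤ l) (x : ℝ) : soft l (-x) = -soft l x := by
  rw [soft_eq hl, soft_eq hl]; ring_nf

lemma soft_of_le {l x : ℝ} (hl : 0 ≤ l) (h : l ≤ x) : soft l x = x - l := by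
  rw [soft_eq hl, max_eq_left (by linarith), max_eq_right (by linarith)]; ring

lemma soft_of_abs_le {l x : ℝ} (h : |x| ≤ l) : soft l x = 0 := by
  rw [soft, max_eq_right (by linarith), mul_zero]

lemma soft_sq_le_soft_sq {l m x : ℝ} (hl : 0 ≤ l) (hm : l ≤ m) : soft m x ^ 2 ≤ soft l x ^ 2 := by
  rw [soft_sq hl, soft_sq (hl.trans hm)]
  gcongr

lemma soft_sq_le_sq {l x : ℝ} (hl : 0 ≤ l) : soft l x ^ 2 ≤ x ^ 2 := by
  have h := soft_sq_le_soft_sq (x := x) le_rfl hl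
  have h0 : soft 0 x = x := by
    rw [soft_eq le_rfl]
    rcases le_total x 0 with h | h
    · rw [max_eq_right (by linarith), max_eq_left (by linarith)]; ring
    · rw [max_eq_left (by linarith), max_eq_right (by linarith)]; ring
  rwa [h0] at h

lemma continuous_soft {l : ℝ} (hl : 0 ≤ l) : Continuous (soft l) := by
  rw [funext (soft_eq hl)]
  fun_prop

/-- Soft thresholding of signal plus noise errs at most by the thresholded noise plus the signal. -/
lemma abs_soft_add_sub_le {l : ℝ} (hl : 0 ≤ l) (θ z : ℝ) :
    |soft l (θ + z) - θ| ≤ |soft l z| + |θ| := by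
  rw [soft_eq hl, soft_eq hl]
  rcases max_cases (θ + z - l) 0 with ⟨h1, h1'⟩ | ⟨h1, h1'⟩ <;>
  rcases max_cases (-(θ + z) - l) 0 with ⟨h2, h2'⟩ | ⟨h2, h2'⟩ <;>
  rcases max_cases (z - l) 0 with ⟨h3, h3'⟩ | ⟨h3, h3'⟩ <;>
  rcases max_cases (-z - l) 0 with ⟨h4, h4'⟩ | ⟨h4, h4'⟩ <;>
  rw [h1, h2, h3, h4] <;> grind

lemma abs_soft_add_sub_le_min {l : ℝ} (hl : 0 ≤ l) (θ z : ℝ) :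
    |soft l (θ + z) - θ| ≤ min |θ| l + |z| := by
  rw [soft_eq hl]
  rcases max_cases (θ + z - l) 0 with ⟨h1, h1'⟩ | ⟨h1, h1'⟩ <;>
  rcases max_cases (-(θ + z) - l) 0 with ⟨h2, h2'⟩ | ⟨h2, h2'⟩ <;>
  rw [h1, h2] <;> grind

lemma min_sub_le_abs_soft_add_sub {l : ℝ} (hl : 0 ≤ l) (θ z : ℝ) :
    min |θ| l - |z| ≤ |soft l (θ + z) - θ| := by
  rw [soft_eq hl]
  rcases max_cases (θ + z - l) 0 with ⟨h1, h1'⟩ | ⟨h1, h1'⟩ <;>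
  rcases max_cases (-(θ + z) - l) 0 with ⟨h2, h2'⟩ | ⟨h2, h2'⟩ <;>
  rw [h1, h2] <;> grind

/-- Pathwise bound for the loss of a coordinate; the second summand only involves the noise. -/
lemma soft_add_sub_sq_le {l ε A : ℝ} (hl : 0 ≤ l) (hε : 0 < ε) {θ z μ : ℝ}
    (hμ : |θ| < A → |θ| ≤ μ) (hμ' : min |θ| l ≤ μ) :
    (soft l (θ + z) - θ) ^ 2
      ≤ (1 + ε) * μ ^ 2 + (1 + 1 / ε) * (soft l z ^ 2 + if A ≤ |θ| then z ^ 2 else 0) := by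
  -- Weighted Young inequality: the bias must keep a constant close to 1, while the noise may carry
  -- a large one.
  have key : ∀ a b : ℝ, (a + b) ^ 2 ≤ (1 + ε) * a ^ 2 + (1 + 1 / ε) * b ^ 2 := fun a b => by
    have h : (1 + ε) * a ^ 2 + (1 + 1 / ε) * b ^ 2 - (a + b) ^ 2 = (ε * a - b) ^ 2 / ε := by
      field_simp; ring
    have : 0 ≤ (ε * a - b) ^ 2 / ε := by positivity
    linarith
  have hε' : 0 ≤ 1 + 1 / ε := by positivity
  rw [← sq_abs]
  -- A large signal is charged its whole noise, which is affordable because such signals are few. A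
  -- small one is charged only the noise surviving the threshold.
  split_ifs with h
  · have h1 := abs_soft_add_sub_le_min hl θ z
    calc |soft l (θ + z) - θ| ^ 2 ≤ (μ + |z|) ^ 2 := by
          gcongr; linarith
      _ ≤ (1 + ε) * μ ^ 2 + (1 + 1 / ε) * |z| ^ 2 := key _ _
      _ ≤ _ := by
          rw [sq_abs]
          gcongr
          nlinarith [sq_nonneg (soft l z)]
  · have h1 := abs_soft_add_sub_le hl θ z
    calc |soft l (θ + z) - θ| ^ 2 ≤ (μ + |soft l z|) ^ 2 := by
          have := hμ (not_le.1 h)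
          gcongr; linarith
      _ ≤ (1 + ε) * μ ^ 2 + (1 + 1 / ε) * |soft l z| ^ 2 := key _ _
      _ = _ := by rw [sq_abs, add_zero]

/-! ### Risk of thresholding pure noise -/

lemma integrable_soft_sq {l : ℝ} (hl : 0 ≤ l) : Integrable (fun z => soft l z ^ 2) stdGaussian :=
  integrable_sq_stdGaussian.mono' ((continuous_soft hl).pow 2).aestronglyMeasurable
    (ae_of_all _ fun z => by
      rw [Real.norm_of_nonneg (sq_nonneg _)]
      exact soft_sq_le_sq hl)

lemma noiseRisk_le_one {l : ℝ} (hl : 0 ≤ l) : noiseRisk l ≤ 1 := by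
  rw [← integral_sq_stdGaussian]
  exact integral_mono (integrable_soft_sq hl) integrable_sq_stdGaussian
    fun z => soft_sq_le_sq hl

lemma noiseRisk_antitoneOn : AntitoneOn noiseRisk (Set.Ici 0) := fun _ hl _ hm h =>
  integral_mono (integrable_soft_sq hm) (integrable_soft_sq hl)
    fun _ => soft_sq_le_soft_sq hl h

lemma integrable_max_sub_sq {l : ℝ} (hl : 0 ≤ l) :
    Integrable (fun z => max (z - l) 0 ^ 2) stdGaussian := by
  refine (integrable_soft_sq hl).mono' (by fun_prop) (ae_of_all _ fun z => ?_)
  rw [Real.norm_of_nonneg (sq_nonneg _), soft_sq hl]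
  exact le_add_of_nonneg_right (sq_nonneg _)

lemma noiseRisk_eq_two_mul {l : ℝ} (hl : 0 ≤ l) :
    noiseRisk l = 2 * ∫ z, max (z - l) 0 ^ 2 ∂stdGaussian := by
  have hi := integrable_max_sub_sq hl
  have hi' : Integrable (fun z => max (-z - l) 0 ^ 2) stdGaussian := by
    refine (integrable_soft_sq hl).mono' (by fun_prop) (ae_of_all _ fun z => ?_)
    rw [Real.norm_of_nonneg (sq_nonneg _), soft_sq hl]
    exact le_add_of_nonneg_left (sq_nonneg _)
  have h := integral_stdGaussian_neg (fun z => max (z - l) 0 ^ 2)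
  rw [noiseRisk, integral_congr_ae (ae_of_all _ (soft_sq hl)), integral_add hi hi', h]
  ring

lemma noiseRisk_eq_integral_exp {l : ℝ} (hl : 0 ≤ l) :
    noiseRisk l = 2 * ∫ z, max z 0 ^ 2 * Real.exp (-l * z - l ^ 2 / 2) ∂stdGaussian := by
  have h := integral_stdGaussian_shift (fun z => max z 0 ^ 2) (-l)
  rw [noiseRisk_eq_two_mul hl]
  simp only [neg_sq] at h
  rw [← h]
  congr 2
  ext z
  ring_nf

lemma integrable_max_sq_mul_exp {l : ℝ} (hl : 0 ≤ l) :
    Integrable (fun z => max z 0 ^ 2 * Real.exp (-l * z - l ^ 2 / 2)) stdGaussian := by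
  refine integrable_sq_stdGaussian.mono' (by fun_prop) (ae_of_all _ fun z => ?_)
  rw [Real.norm_of_nonneg (by positivity)]
  rcases le_total z 0 with h | h
  · rw [max_eq_right h]; simp; positivity
  · rw [max_eq_left h]
    have : Real.exp (-l * z - l ^ 2 / 2) ≤ 1 := Real.exp_le_one_iff.2 (by nlinarith [mul_nonneg hl h])
    nlinarith [sq_nonneg z]

/-- Only `z ∈ (1, 2]` is kept after the shift. The lost factor `exp (-2 l)` is harmless, since the
quantity compared with this bound is smaller by a factor whose exponent is quadratic in `l`. -/
lemma exists_le_noiseRisk :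
    ∃ c : ℝ, 0 < c ∧ ∀ l : ℝ, 0 ≤ l → c * Real.exp (-l ^ 2 / 2 - 2 * l) ≤ noiseRisk l := by
  have hpos := measure_Ioc_stdGaussian_pos (s := 1) (t := 2) (by norm_num)
  refine ⟨2 * stdGaussian.real (Set.Ioc 1 2), by positivity, fun l hl => ?_⟩
  rw [noiseRisk_eq_integral_exp hl, mul_assoc]
  gcongr
  have hi := integrable_max_sq_mul_exp hl
  calc stdGaussian.real (Set.Ioc 1 2) * Real.exp (-l ^ 2 / 2 - 2 * l)
      = ∫ z in Set.Ioc 1 2, Real.exp (-l ^ 2 / 2 - 2 * l) ∂stdGaussian := by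
        rw [setIntegral_const, smul_eq_mul]
    _ ≤ ∫ z in Set.Ioc 1 2, max z 0 ^ 2 * Real.exp (-l * z - l ^ 2 / 2) ∂stdGaussian := by
        refine setIntegral_mono_on (integrable_const _).integrableOn hi.integrableOn
          measurableSet_Ioc fun z hz => ?_
        have h1 : (1 : ℝ) ≤ max z 0 ^ 2 := by
          rw [max_eq_left (by linarith [hz.1])]; nlinarith [hz.1]
        have h2 : Real.exp (-l ^ 2 / 2 - 2 * l) ≤ Real.exp (-l * z - l ^ 2 / 2) :=
          Real.exp_le_exp.2 (by nlinarith [hz.2])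
        calc Real.exp (-l ^ 2 / 2 - 2 * l) ≤ Real.exp (-l * z - l ^ 2 / 2) := h2
          _ ≤ _ := le_mul_of_one_le_left (Real.exp_pos _).le h1
    _ ≤ _ := setIntegral_le_integral hi (ae_of_all _ fun z => by positivity)

lemma noiseRisk_pos {l : ℝ} (hl : 0 ≤ l) : 0 < noiseRisk l := by
  obtain ⟨c, hc, h⟩ := exists_le_noiseRisk
  exact (by positivity : 0 < c * Real.exp (-l ^ 2 / 2 - 2 * l)).trans_le (h l hl)

/-- With the density bounded by 1, a Gamma integral `2 / l ^ 3` remains. At `l` of order `√(log n)`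
this cube produces the factor `(log n) ^ (-3/2)` of `L0`. -/
lemma noiseRisk_le_exp {l : ℝ} (hl : 0 < l) :
    noiseRisk l ≤ 4 * Real.exp (-l ^ 2 / 2) / l ^ 3 := by
  have hG := Real.integral_rpow_mul_exp_neg_mul_Ioi (a := 3) (r := l) (by norm_num) hl
  have hG' : ∫ t in Set.Ioi (0 : ℝ), t ^ 2 * Real.exp (-(l * t)) = 2 / l ^ 3 := by
    have h3 : Real.Gamma 3 = 2 := by
      have := Real.Gamma_nat_eq_factorial 2
      norm_num at this ⊢
    rw [h3] at hG
    norm_num at hG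
    rw [hG]
    ring
  -- A nonintegrable function would have integral 0 by convention, but the value just computed is
  -- positive.
  have hGi : IntegrableOn (fun t => t ^ 2 * Real.exp (-(l * t))) (Set.Ioi (0 : ℝ)) := by
    by_contra hcon
    rw [integral_undef hcon] at hG'
    have : 0 < 2 / l ^ 3 := by positivity
    linarith
  rw [noiseRisk_eq_integral_exp hl.le, integral_stdGaussian]
  have hpdf : ∀ z, gaussianPDFReal 0 1 z ≤ 1 := fun z => by
    simp only [gaussianPDFReal]
    have h1 : (Real.sqrt (2 * Real.pi * (1 : NNReal)))⁻¹ ≤ 1 := by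
      apply inv_le_one_of_one_le₀
      rw [Real.one_le_sqrt]
      simp
      linarith [Real.two_le_pi]
    have h2 : Real.exp (-(z - 0) ^ 2 / (2 * (1 : NNReal))) ≤ 1 := Real.exp_le_one_iff.2 (by
      rw [neg_div]
      exact neg_nonpos.2 (by positivity))
    exact mul_le_one₀ h1 (Real.exp_pos _).le h2
  have hle : ∫ z, gaussianPDFReal 0 1 z * (max z 0 ^ 2 * Real.exp (-l * z - l ^ 2 / 2))
      ≤ ∫ z in Set.Ioi (0 : ℝ), Real.exp (-l ^ 2 / 2) * (z ^ 2 * Real.exp (-(l * z))) := by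
    rw [← integral_indicator measurableSet_Ioi]
    refine integral_mono_of_nonneg (ae_of_all _ fun z => mul_nonneg
      (gaussianPDFReal_nonneg _ _ _) (by positivity))
      ((integrable_indicator_iff measurableSet_Ioi).2 (hGi.const_mul _)) (ae_of_all _ fun z => ?_)
    by_cases hz : 0 < z
    · simp only [Set.indicator_of_mem (Set.mem_Ioi.2 hz), max_eq_left hz.le]
      calc gaussianPDFReal 0 1 z * (z ^ 2 * Real.exp (-l * z - l ^ 2 / 2))
          ≤ z ^ 2 * Real.exp (-l * z - l ^ 2 / 2) :=
            mul_le_of_le_one_left (by positivity) (hpdf z)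
        _ = _ := by
            rw [mul_left_comm, ← Real.exp_add]
            ring_nf
    · have : z ∉ Set.Ioi (0 : ℝ) := hz
      simp [this, max_eq_right (not_lt.1 hz)]
  rw [integral_const_mul, hG'] at hle
  calc _ ≤ 2 * (Real.exp (-l ^ 2 / 2) * (2 / l ^ 3)) := by gcongr
    _ = _ := by ring

lemma exists_noiseRisk_le_gaussianTail :
    ∃ C : ℝ, 0 < C ∧ ∀ l : ℝ, 0 ≤ l → noiseRisk l ≤ C * gaussianTail l := by
  obtain ⟨C, hC, h⟩ := exp_le_mul_gaussianTail
  have h1 := gaussianTail_pos 1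
  refine ⟨4 * C + 1 / gaussianTail 1, by positivity, fun l hl => ?_⟩
  have hT := gaussianTail_pos l
  rw [add_mul]
  rcases le_total l 1 with hl1 | hl1
  · have h2 : 1 ≤ 1 / gaussianTail 1 * gaussianTail l := by
      rw [div_mul_eq_mul_div, one_mul, one_le_div h1]
      exact gaussianTail_antitone hl1
    have : 0 ≤ 4 * C * gaussianTail l := by positivity
    linarith [noiseRisk_le_one hl]
  · have hl0 : 0 < l := by linarith
    have h2 : noiseRisk l ≤ 4 * C * gaussianTail l := by
      refine (noiseRisk_le_exp hl0).trans ?_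
      rw [div_le_iff₀ (by positivity)]
      have h3 := h l hl1
      have h4 : l ≤ l ^ 3 := le_self_pow₀ hl1 (by norm_num)
      calc 4 * Real.exp (-l ^ 2 / 2) ≤ 4 * (C * l * gaussianTail l) := by gcongr
        _ = 4 * C * gaussianTail l * l := by ring
        _ ≤ _ := by gcongr
    have : 0 ≤ 1 / gaussianTail 1 * gaussianTail l := by positivity
    linarith

/-! ### Exceedance probabilities of signal plus noise -/

/-- The probability that `|θ + Z| ≥ t` for standard normal `Z`. -/
noncomputable def exceedance (θ t : ℝ) : ℝ := stdGaussian.real {z | t ≤ |θ + z|}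

lemma measurableSet_le_abs_add (θ t : ℝ) : MeasurableSet {z : ℝ | t ≤ |θ + z|} :=
  measurableSet_le measurable_const (by fun_prop)

lemma exceedance_nonneg (θ t : ℝ) : 0 ≤ exceedance θ t := measureReal_nonneg

lemma exceedance_le_one (θ t : ℝ) : exceedance θ t ≤ 1 := measureReal_le_one

lemma exceedance_neg (θ t : ℝ) : exceedance (-θ) t = exceedance θ t := by
  rw [exceedance, exceedance, ← integral_indicator_one (measurableSet_le_abs_add _ _),
    ← integral_indicator_one (measurableSet_le_abs_add _ _), ← integral_stdGaussian_neg]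
  congr 1
  ext z
  simp only [Set.indicator_apply, Set.mem_ofPred_eq, ← neg_add, abs_neg, Pi.one_apply]

lemma exceedance_abs (θ t : ℝ) : exceedance |θ| t = exceedance θ t := by
  rcases abs_choice θ with h | h <;> rw [h]
  exact exceedance_neg θ t

lemma exceedance_zero {t : ℝ} (ht : 0 < t) : exceedance 0 t = 2 * gaussianTail t := by
  have h : {z : ℝ | t ≤ |0 + z|} = Set.Iic (-t) ∪ Set.Ici t := by
    ext z
    simp only [Set.mem_ofPred_eq, Set.mem_union, Set.mem_Iic, Set.mem_Ici, zero_add, le_abs']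
  rw [exceedance, h, measureReal_union _ measurableSet_Ici, measureReal_Iic_neg_stdGaussian,
    measureReal_Ici_stdGaussian]
  · ring
  · exact Set.disjoint_left.2 fun x hx hx' => by
      simp only [Set.mem_Iic, Set.mem_Ici] at hx hx'
      linarith

lemma gaussianTail_sub_abs_le_exceedance (θ t : ℝ) : gaussianTail (t - |θ|) ≤ exceedance θ t := by
  rw [← exceedance_abs]
  refine measureReal_mono fun z hz => ?_
  simp only [Set.mem_Ioi, Set.mem_ofPred_eq] at hz ⊢
  exact le_trans (by linarith) (le_abs_self _)

lemma cosh_sub_one_le (y : ℝ) : Real.cosh y - 1 ≤ y ^ 2 * Real.exp |y| := by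
  wlog hy : 0 ≤ y generalizing y
  · have := this (-y) (by linarith)
    simpa using this
  rw [abs_of_nonneg hy]
  have h1 : 1 - Real.exp (-y) ≤ y := by linarith [Real.one_sub_le_exp_neg y]
  have h0 : 0 ≤ 1 - Real.exp (-y) := by
    have := Real.exp_le_one_iff.2 (by linarith : -y ≤ 0)
    linarith
  have h2 : Real.cosh y - 1 = Real.exp y * (1 - Real.exp (-y)) ^ 2 / 2 := by
    rw [Real.cosh_eq]
    have : Real.exp y * Real.exp (-y) = 1 := by rw [← Real.exp_add]; simp
    linear_combination (1 - Real.exp (-y) / 2) * this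
  have h3 : (1 - Real.exp (-y)) ^ 2 ≤ y ^ 2 := by gcongr
  rw [h2]
  nlinarith [Real.exp_pos y, sq_nonneg y]

/-- Averaging the shifts by `θ` and `-θ` cancels the linear term: the density ratio is at most `cosh
(θ z)`, which differs from 1 to second order in `θ`. -/
lemma exceedance_sub_le {θ A : ℝ} (hθ : |θ| ≤ A) (t : ℝ) :
    exceedance θ t - exceedance 0 t
      ≤ θ ^ 2 * ∫ z in {z : ℝ | t ≤ |z|}, z ^ 2 * Real.exp (A * |z|) ∂stdGaussian := by
  set S : Set ℝ := {z | t ≤ |z|} with hS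
  have hSm : MeasurableSet S := measurableSet_le measurable_const (by fun_prop)
  have h0 : exceedance 0 t = ∫ z in S, 1 ∂stdGaussian := by
    simp [exceedance, hS]
  have h1 : exceedance θ t = ∫ z in S, Real.exp (θ * z - θ ^ 2 / 2) ∂stdGaussian := by
    have h := integral_stdGaussian_shift (S.indicator 1) θ
    rw [exceedance, ← integral_indicator_one (measurableSet_le_abs_add _ _),
      ← integral_indicator hSm]
    refine Eq.trans ?_ (h.trans ?_)
    · rfl
    · congr 1
      ext z
      simp [Set.indicator_apply]
  have h2 : exceedance θ t = ∫ z in S, Real.exp (-θ * z - θ ^ 2 / 2) ∂stdGaussian := by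
    have h := integral_stdGaussian_neg (S.indicator fun z => Real.exp (θ * z - θ ^ 2 / 2))
    rw [h1, ← integral_indicator hSm, ← integral_indicator hSm, ← h]
    congr 1
    ext z
    simp [hS, Set.indicator]
  have hi1 := (integrable_exp_linear θ (θ ^ 2 / 2)).integrableOn (s := S)
  have hi2 := (integrable_exp_linear (-θ) (θ ^ 2 / 2)).integrableOn (s := S)
  have h3 : exceedance θ t = ∫ z in S, (Real.exp (θ * z - θ ^ 2 / 2)
      + Real.exp (-θ * z - θ ^ 2 / 2)) / 2 ∂stdGaussian := by
    rw [integral_div, integral_add hi1 hi2, ← h1, ← h2]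
    ring
  have hi3 : IntegrableOn (fun z => (Real.exp (θ * z - θ ^ 2 / 2)
      + Real.exp (-θ * z - θ ^ 2 / 2)) / 2) S stdGaussian := (hi1.add hi2).div_const 2
  rw [h3, h0, ← integral_sub hi3 (integrable_const _).integrableOn, ← integral_const_mul]
  refine setIntegral_mono_on (hi3.sub (integrable_const _).integrableOn)
    ((integrable_sq_mul_exp_abs A).const_mul _).integrableOn hSm fun z _ => ?_
  have h4 : (Real.exp (θ * z - θ ^ 2 / 2) + Real.exp (-θ * z - θ ^ 2 / 2)) / 2
      ≤ Real.cosh (θ * z) := by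
    rw [Real.cosh_eq]
    have h5 : Real.exp (θ * z - θ ^ 2 / 2) ≤ Real.exp (θ * z) :=
      Real.exp_le_exp.2 (by nlinarith [sq_nonneg θ])
    have h6 : Real.exp (-θ * z - θ ^ 2 / 2) ≤ Real.exp (-(θ * z)) :=
      Real.exp_le_exp.2 (by nlinarith [sq_nonneg θ])
    linarith
  calc _ ≤ Real.cosh (θ * z) - 1 := by linarith
    _ ≤ (θ * z) ^ 2 * Real.exp |θ * z| := cosh_sub_one_le _
    _ ≤ (θ * z) ^ 2 * Real.exp (A * |z|) := by
        rw [abs_mul]; gcongr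
    _ = _ := by ring

/-- The excess exceedance probability is a bounded fraction of the squared signal. -/
lemma exists_exceedance_sub_le :
    ∃ C : ℝ, 0 < C ∧ ∀ θ t l : ℝ, 1 ≤ l →
      exceedance θ t - exceedance 0 t ≤ C * min |θ| l ^ 2 := by
  have hI := integrable_sq_mul_exp_abs 1
  set I := ∫ z, z ^ 2 * Real.exp (1 * |z|) ∂stdGaussian with hIdef
  have hI0 : 0 ≤ I := integral_nonneg fun z => by positivity
  refine ⟨I + 1, by positivity, fun θ t l hl => ?_⟩
  rcases le_total |θ| 1 with h | h
  · refine (exceedance_sub_le h t).trans ?_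
    rw [min_eq_left (h.trans hl), sq_abs]
    have h1 : ∫ z in {z : ℝ | t ≤ |z|}, z ^ 2 * Real.exp (1 * |z|) ∂stdGaussian ≤ I :=
      setIntegral_le_integral hI (ae_of_all _ fun z => by positivity)
    nlinarith [sq_nonneg θ]
  · have h1 : 1 ≤ min |θ| l := le_min h hl
    have h2 : 1 ≤ min |θ| l ^ 2 := one_le_pow₀ h1
    nlinarith [exceedance_le_one θ t, exceedance_nonneg 0 t]

/-- At high levels the excess exceedance probability is a small fraction of the squared signal. -/
lemma exists_exceedance_sub_le_small {ρ : ℝ} (hρ : 0 < ρ) :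
    ∃ T L : ℝ, ∀ θ t l : ℝ, T ≤ t → L ≤ l →
      exceedance θ t - exceedance 0 t ≤ ρ * min |θ| l ^ 2 := by
  -- For `|θ| ≥ A` the right side is at least 1 once `l ≥ A`, so only signals below `A` need the
  -- second-order bound.
  obtain ⟨A, hA0, hA⟩ : ∃ A : ℝ, 0 < A ∧ 1 ≤ ρ * A ^ 2 := by
    refine ⟨Real.sqrt (1 / ρ), by positivity, ?_⟩
    rw [Real.sq_sqrt (by positivity)]
    field_simp
    rfl
  have hI := integrable_sq_mul_exp_abs A
  have hlim : Tendsto (fun t : ℝ => ∫ z in {z : ℝ | t ≤ |z|}, z ^ 2 * Real.exp (A * |z|)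
      ∂stdGaussian) atTop (𝓝 0) := by
    have h := tendsto_setIntegral_of_antitone (μ := stdGaussian)
      (f := fun z : ℝ => z ^ 2 * Real.exp (A * |z|)) (s := fun t : ℝ => {z : ℝ | t ≤ |z|})
      (fun t => measurableSet_le measurable_const (by fun_prop))
      (fun s t hst z hz => le_trans hst hz) ⟨0, hI.integrableOn⟩
    have he : ⋂ t : ℝ, {z : ℝ | t ≤ |z|} = ∅ := by
      ext z
      simp only [Set.mem_iInter, Set.mem_ofPred_eq, Set.mem_empty_iff_false, iff_false, not_forall,
        not_le]
      exact ⟨|z| + 1, by linarith⟩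
    rwa [he, setIntegral_empty] at h
  obtain ⟨T, hT⟩ := eventually_atTop.1 (hlim.eventually_le_const hρ)
  refine ⟨T, A, fun θ t l ht hl => ?_⟩
  rcases le_total |θ| A with h | h
  · refine (exceedance_sub_le h t).trans ?_
    rw [min_eq_left (h.trans hl), sq_abs]
    have := hT t ht
    nlinarith [sq_nonneg θ]
  · have h1 : A ≤ min |θ| l := le_min h hl
    have h2 : A ^ 2 ≤ min |θ| l ^ 2 := by gcongr
    nlinarith [exceedance_le_one θ t, exceedance_nonneg 0 t]

/-- A signal of size at least `v ≥ t` exceeds the levels `s ≥ t` at the rate of the null. -/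
lemma gaussianTail_div_le_exceedance {θ t s : ℝ} (ht : 0 ≤ t) (hθ : t ≤ |θ|) (hs : t ≤ s) :
    gaussianTail s / (2 * gaussianTail t) ≤ exceedance θ s := by
  have h1 := gaussianTail_add_le ht (sub_nonneg.2 hs)
  rw [add_sub_cancel] at h1
  have h2 : gaussianTail (s - t) ≤ gaussianTail (s - |θ|) := gaussianTail_antitone (by linarith)
  have h3 := gaussianTail_sub_abs_le_exceedance θ s
  have h4 := gaussianTail_pos t
  rw [div_le_iff₀ (by positivity)]
  nlinarith

lemma half_le_exceedance {θ s : ℝ} (h : s ≤ |θ|) : 1 / 2 ≤ exceedance θ s := by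
  refine le_trans ?_ (gaussianTail_sub_abs_le_exceedance θ s)
  rw [← gaussianTail_zero]
  exact gaussianTail_antitone (by linarith)

/-! ### Lower bounds for the risk of a coordinate -/

/-- The risk of soft thresholding of one observation. -/
noncomputable def coordRisk (l θ : ℝ) : ℝ := ∫ z, (soft l (θ + z) - θ) ^ 2 ∂stdGaussian

lemma integrable_coordRisk {l : ℝ} (hl : 0 ≤ l) (θ : ℝ) :
    Integrable (fun z => (soft l (θ + z) - θ) ^ 2) stdGaussian := by
  have hc : Continuous fun z => (soft l (θ + z) - θ) ^ 2 :=
    (((continuous_soft hl).comp (continuous_const_add θ)).sub continuous_const).pow 2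
  refine ((integrable_sq_stdGaussian.const_mul 2).add (integrable_const (2 * θ ^ 2))).mono'
    hc.aestronglyMeasurable (ae_of_all _ fun z => ?_)
  rw [Real.norm_of_nonneg (sq_nonneg _)]
  have h1 := abs_soft_add_sub_le hl θ z
  have h2 := soft_sq_le_sq (x := z) hl
  rw [← sq_abs]
  calc |soft l (θ + z) - θ| ^ 2 ≤ (|soft l z| + |θ|) ^ 2 := by gcongr
    _ ≤ 2 * |soft l z| ^ 2 + 2 * |θ| ^ 2 := by nlinarith [sq_nonneg (|soft l z| - |θ|)]
    _ ≤ _ := by rw [sq_abs, sq_abs, Pi.add_apply]; linarith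

lemma coordRisk_neg {l : ℝ} (hl : 0 ≤ l) (θ : ℝ) : coordRisk l (-θ) = coordRisk l θ := by
  rw [coordRisk, coordRisk, ← integral_stdGaussian_neg]
  congr 1
  ext z
  rw [← neg_add, soft_neg hl]
  ring

/-- For `θ ≥ 0` and `z ≥ l` the error is exactly `z - l`, whatever the signal. Only this side of the
noise is controlled, hence the half. -/
lemma noiseRisk_le_coordRisk {l : ℝ} (hl : 0 ≤ l) (θ : ℝ) :
    noiseRisk l / 2 ≤ coordRisk l θ := by
  wlog hθ : 0 ≤ θ generalizing θ
  · rw [← coordRisk_neg hl]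
    exact this (-θ) (by linarith)
  rw [noiseRisk_eq_two_mul hl, mul_div_cancel_left₀ _ two_ne_zero]
  refine integral_mono (integrable_max_sub_sq hl) (integrable_coordRisk hl θ) fun z => ?_
  rcases le_total z l with h | h
  · simp only [max_eq_right (sub_nonpos.2 h), ne_eq, OfNat.ofNat_ne_zero, not_false_eq_true,
      zero_pow]
    exact sq_nonneg _
  · simp only [max_eq_left (sub_nonneg.2 h), soft_of_le hl (by linarith : l ≤ θ + z)]
    exact le_of_eq (by ring)

/-- If `|θ| ≤ 2 / ε`, the observation is set to zero with probability at least `1 - ε`, and the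
error is then `θ`. Otherwise the error is at least `min |θ| l - |z|`, and the unit variance of the
noise is absorbed because the minimum is at least `2 / ε`. -/
lemma exists_le_coordRisk {ε : ℝ} (hε : 0 < ε) :
    ∃ L : ℝ, ∀ l θ : ℝ, L ≤ l → (1 - ε) * min |θ| l ^ 2 ≤ coordRisk l θ := by
  obtain ⟨B, hB⟩ : ∃ B : ℝ, exceedance 0 B ≤ ε := by
    have h := tendsto_gaussianTail_atTop.eventually_le_const (half_pos hε)
    obtain ⟨B, hB, hB0⟩ := (h.and (eventually_gt_atTop 0)).exists
    exact ⟨B, by rw [exceedance_zero hB0]; linarith⟩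
  have hA : 0 < 2 / ε := by positivity
  refine ⟨max (2 / ε + B) (2 / ε), fun l θ hl => ?_⟩
  have hl1 := (le_max_left _ _).trans hl
  have hl2 := (le_max_right _ _).trans hl
  have hl0 : 0 ≤ l := hA.le.trans hl2
  rcases le_total |θ| (2 / ε) with h | h
  · rw [min_eq_left (h.trans hl2), sq_abs]
    have hm := measurableSet_le_abs_add 0 B
    have h1 : (1 - ε) ≤ stdGaussian.real {z : ℝ | B ≤ |0 + z|}ᶜ := by
      rw [probReal_compl_eq_one_sub hm]
      unfold exceedance at hB
      linarith
    calc (1 - ε) * θ ^ 2 ≤ stdGaussian.real {z : ℝ | B ≤ |0 + z|}ᶜ * θ ^ 2 := by gcongr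
      _ = ∫ z in {z : ℝ | B ≤ |0 + z|}ᶜ, θ ^ 2 ∂stdGaussian := by
          rw [setIntegral_const, smul_eq_mul]
      _ ≤ ∫ z in {z : ℝ | B ≤ |0 + z|}ᶜ, (soft l (θ + z) - θ) ^ 2 ∂stdGaussian := by
          refine setIntegral_mono_on (integrable_const _).integrableOn
            (integrable_coordRisk hl0 θ).integrableOn hm.compl fun z hz => ?_
          simp only [Set.mem_compl_iff, Set.mem_ofPred_eq, not_le, zero_add] at hz
          rw [soft_of_abs_le ((abs_add_le θ z).trans (by linarith))]
          exact le_of_eq (by ring)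
      _ ≤ _ := setIntegral_le_integral (integrable_coordRisk hl0 θ)
          (ae_of_all _ fun z => sq_nonneg _)
  · set m := min |θ| l with hm
    have hm1 : 2 / ε ≤ m := le_min h hl2
    have hm0 : 0 < m := hA.trans_le hm1
    have h1 : ∀ z : ℝ, (1 - ε / 2) * m ^ 2 - 2 / ε * z ^ 2 ≤ (soft l (θ + z) - θ) ^ 2 := by
      intro z
      have h2 := min_sub_le_abs_soft_add_sub hl0 θ z
      rw [← hm] at h2
      have h3 : (1 - ε / 2) * m ^ 2 - 2 / ε * z ^ 2 ≤ max (m - |z|) 0 ^ 2 := by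
        have h4 : (m - |z|) ^ 2 - ((1 - ε / 2) * m ^ 2 - 2 / ε * z ^ 2)
            = (ε * m / 2 - |z|) ^ 2 * (2 / ε) + |z| ^ 2 := by
          rw [← sq_abs z]; field_simp; ring
        rcases le_total m |z| with h5 | h5
        · rw [max_eq_right (by linarith)]
          have h6 : m ^ 2 ≤ z ^ 2 := by rw [← sq_abs z]; gcongr
          by_cases hε2 : ε ≤ 2
          · have h7 : 1 ≤ 2 / ε := by rw [one_le_div hε]; exact hε2
            nlinarith [sq_nonneg m, sq_nonneg z]
          · have h7 : 0 ≤ 2 / ε * z ^ 2 := by positivity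
            nlinarith [sq_nonneg m]
        · rw [max_eq_left (by linarith)]
          have h8 : 0 ≤ (ε * m / 2 - |z|) ^ 2 * (2 / ε) + |z| ^ 2 := by positivity
          linarith
      have h5 : max (m - |z|) 0 ≤ |soft l (θ + z) - θ| := max_le h2 (abs_nonneg _)
      refine h3.trans ?_
      rw [← sq_abs (soft l (θ + z) - θ)]
      gcongr
    have h2 : ∫ z, ((1 - ε / 2) * m ^ 2 - 2 / ε * z ^ 2) ∂stdGaussian ≤ coordRisk l θ :=
      integral_mono ((integrable_const _).sub (integrable_sq_stdGaussian.const_mul _))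
        (integrable_coordRisk hl0 θ) h1
    rw [integral_sub (integrable_const _) (integrable_sq_stdGaussian.const_mul _),
      integral_const, integral_const_mul (2 / ε), integral_sq_stdGaussian] at h2
    simp only [probReal_univ, one_smul, mul_one] at h2
    refine le_trans ?_ h2
    have h3 : 2 / ε ≤ ε / 2 * m ^ 2 := by
      calc 2 / ε = ε / 2 * (2 / ε) ^ 2 := by field_simp
        _ ≤ _ := by gcongr
    linarith

section Observations

variable {n : ℕ} {Ω : Type*} [MeasurableSpace Ω] {P : Measure Ω}
  {θ : Fin n → ℝ} {X : Fin n → Ω → ℝ}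

lemma hasLaw_noise (hX : ∀ i, HasLaw (X i) (gaussianReal (θ i) 1) P) (i : Fin n) :
    HasLaw (fun ω => X i ω - θ i) stdGaussian P := by
  have h := gaussianReal_sub_const (hX i) (θ i)
  rwa [sub_self] at h

lemma integral_noise (hX : ∀ i, HasLaw (X i) (gaussianReal (θ i) 1) P) (i : Fin n) {f : ℝ → ℝ}
    (hf : AEStronglyMeasurable f stdGaussian) :
    ∫ ω, f (X i ω - θ i) ∂P = ∫ z, f z ∂stdGaussian :=
  (hasLaw_noise hX i).integral_comp hf

lemma integrable_noise (hX : ∀ i, HasLaw (X i) (gaussianReal (θ i) 1) P) (i : Fin n) {f : ℝ → ℝ}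
    (hf : Integrable f stdGaussian) : Integrable (fun ω => f (X i ω - θ i)) P := by
  have h := hasLaw_noise hX i
  rw [← h.map_eq] at hf
  exact hf.comp_aemeasurable h.aemeasurable

lemma measureReal_le_abs (hX : ∀ i, HasLaw (X i) (gaussianReal (θ i) 1) P) (i : Fin n) (t : ℝ) :
    P.real {ω | t ≤ |X i ω|} = exceedance (θ i) t := by
  have h := (hasLaw_noise hX i).measureReal_eq (p := fun z => t ≤ |θ i + z|)
    (measurableSet_le_abs_add _ _)
  rw [exceedance, ← h]
  simp

lemma risk_const (hX : ∀ i, HasLaw (X i) (gaussianReal (θ i) 1) P) {l : ℝ} (hl : 0 ≤ l) :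
    risk P X θ (fun _ => l) = ∑ i, coordRisk l (θ i) := by
  have h : ∀ i ω, (soft l (X i ω) - θ i) ^ 2
      = (fun z => (soft l (θ i + z) - θ i) ^ 2) (X i ω - θ i) := fun i ω => by simp
  unfold risk loss
  rw [integral_finsetSum]
  · refine Finset.sum_congr rfl fun i _ => ?_
    simp_rw [h i]
    exact integral_noise hX i (integrable_coordRisk hl _).aestronglyMeasurable
  · intro i _
    simp_rw [h i]
    exact integrable_noise hX i (integrable_coordRisk hl _)

/-! ### The number of exceedances -/

lemma count_eq_sum (x : Fin n → ℝ) (s : ℝ) :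
    (count x s : ℝ) = ∑ i, if s ≤ |x i| then (1 : ℝ) else 0 := by
  rw [count, Finset.card_filter]
  push_cast
  rfl

lemma aemeasurable_count (hX : ∀ i, AEMeasurable (X i) P) (s : ℝ) :
    AEMeasurable (fun ω => (count (fun i => X i ω) s : ℝ)) P := by
  simp_rw [count_eq_sum]
  refine Finset.aemeasurable_fun_sum _ fun i _ => ?_
  have hf : Measurable fun x : ℝ => if s ≤ |x| then (1 : ℝ) else 0 :=
    Measurable.ite (measurableSet_le measurable_const (by fun_prop)) measurable_const
      measurable_const
  exact hf.comp_aemeasurable (hX i)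

lemma nullMeasurableSet_le_count (hX : ∀ i, AEMeasurable (X i) P) (s : ℝ) (k : ℕ) :
    NullMeasurableSet {ω | k ≤ count (fun i => X i ω) s} P := by
  have h := nullMeasurableSet_le (aemeasurable_const (b := (k : ℝ))) (aemeasurable_count hX s)
  simpa using h

lemma integral_indicator_one_of_nullMeasurable {s : Set Ω} (hs : NullMeasurableSet s P) :
    ∫ ω, s.indicator (1 : Ω → ℝ) ω ∂P = P.real s := by
  rw [integral_indicator₀ hs]
  simp

variable [IsProbabilityMeasure P]

/-- The expected number of exceedances of a level. -/
noncomputable def meanCount (θ : Fin n → ℝ) (s : ℝ) : ℝ := ∑ i, exceedance (θ i) s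

lemma measurable_exp_indicator (c s : ℝ) :
    Measurable fun x : ℝ => Real.exp (c * if s ≤ |x| then 1 else 0) := by
  have : Measurable fun x : ℝ => if s ≤ |x| then (1 : ℝ) else 0 :=
    Measurable.ite (measurableSet_le measurable_const (by fun_prop)) measurable_const
      measurable_const
  fun_prop

lemma integral_exp_indicator_le (hX : ∀ i, HasLaw (X i) (gaussianReal (θ i) 1) P) (c s : ℝ)
    (j : Fin n) :
    ∫ ω, Real.exp (c * if s ≤ |X j ω| then 1 else 0) ∂P
      ≤ Real.exp ((Real.exp c - 1) * exceedance (θ j) s) := by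
  have h3 : ∀ x : ℝ, Real.exp (c * if s ≤ |x| then 1 else 0)
      = 1 + (Real.exp c - 1) * {x : ℝ | s ≤ |x|}.indicator 1 x := fun x => by
    by_cases hx : s ≤ |x| <;> simp [hx]
  have hns : NullMeasurableSet {ω | s ≤ |X j ω|} P :=
    nullMeasurableSet_le aemeasurable_const (hX j).aemeasurable.abs
  have h4 : ∫ ω, {x : ℝ | s ≤ |x|}.indicator (1 : ℝ → ℝ) (X j ω) ∂P = exceedance (θ j) s := by
    rw [← measureReal_le_abs hX j s, ← integral_indicator_one_of_nullMeasurable hns]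
    rfl
  have hint : Integrable (fun ω => {x : ℝ | s ≤ |x|}.indicator (1 : ℝ → ℝ) (X j ω)) P :=
    (integrable_const (1 : ℝ)).indicator₀ hns
  simp_rw [h3]
  rw [integral_add (integrable_const _) (hint.const_mul _), integral_const_mul, h4]
  simp only [integral_const, probReal_univ, smul_eq_mul, mul_one]
  rw [add_comm]
  exact Real.add_one_le_exp _

/-- Exponential moments of the number of exceedances, weighted by a function of one observation. -/
lemma integral_mul_exp_count_le (hX : ∀ i, HasLaw (X i) (gaussianReal (θ i) 1) P)
    (hind : iIndepFun X P) (s : ℝ) {u : ℝ} (hu : 0 ≤ u) (i : Fin n) {g : ℝ → ℝ}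
    (hg : Measurable g) (hg0 : ∀ x, 0 ≤ g x) (hgi : Integrable (fun ω => g (X i ω)) P) :
    ∫ ω, g (X i ω) * Real.exp (u * count (fun i => X i ω) s) ∂P
      ≤ Real.exp u * Real.exp ((Real.exp u - 1) * meanCount θ s) * ∫ ω, g (X i ω) ∂P := by
  classical
  set h : ℝ → ℝ := fun x => Real.exp (u * if s ≤ |x| then 1 else 0) with hh
  have hhm : Measurable h := measurable_exp_indicator u s
  have hXm : ∀ j, AEMeasurable (X j) P := fun j => (hX j).aemeasurable
  have hle : ∀ x, h x ≤ Real.exp u := fun x => by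
    simp only [hh]; split_ifs <;> simp [hu]
  -- The weight joins the factor of its own coordinate, so independence still factorizes the
  -- expectation. That coordinate costs one extra `exp u`.
  have hprod := hind.integral_fun_prod_comp (𝕜 := ℝ) hXm
    (f := fun j x => if j = i then g x * h x else h x) (fun j => by
      by_cases hj : j = i
      · simp only [hj, if_true]; exact (hg.mul hhm).aestronglyMeasurable
      · simp only [hj, if_false]; exact hhm.aestronglyMeasurable)
  have hexp : ∀ ω, g (X i ω) * Real.exp (u * count (fun i => X i ω) s)
      = ∏ j, (if j = i then g (X j ω) * h (X j ω) else h (X j ω)) := fun ω => by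
    rw [count_eq_sum, Finset.mul_sum, Real.exp_sum]
    have : ∀ j, (if j = i then g (X j ω) * h (X j ω) else h (X j ω))
        = (if j = i then g (X j ω) else 1) * h (X j ω) := fun j => by split_ifs <;> simp
    simp_rw [this, Finset.prod_mul_distrib]
    simp [hh]
  simp_rw [hexp]
  rw [hprod, ← Finset.mul_prod_erase _ _ (Finset.mem_univ i)]
  simp only [if_true]
  have h1 : ∫ ω, g (X i ω) * h (X i ω) ∂P ≤ Real.exp u * ∫ ω, g (X i ω) ∂P := by
    rw [← integral_const_mul]
    refine integral_mono_of_nonneg (ae_of_all _ fun ω => mul_nonneg (hg0 _) (Real.exp_pos _).le)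
      (hgi.const_mul _) (ae_of_all _ fun ω => ?_)
    simp only
    rw [mul_comm]
    exact mul_le_mul_of_nonneg_right (hle _) (hg0 _)
  have h2 := integral_exp_indicator_le hX u s
  have hnn : ∀ j, 0 ≤ ∫ ω, h (X j ω) ∂P := fun j => integral_nonneg fun ω => (Real.exp_pos _).le
  have h5 : ∏ j ∈ Finset.univ.erase i, ∫ ω, (if j = i then g (X j ω) * h (X j ω) else h (X j ω)) ∂P
      ≤ Real.exp ((Real.exp u - 1) * meanCount θ s) := by
    calc _ = ∏ j ∈ Finset.univ.erase i, ∫ ω, h (X j ω) ∂P :=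
          Finset.prod_congr rfl fun j hj => by simp only [Finset.ne_of_mem_erase hj, if_false]
      _ ≤ ∏ j ∈ Finset.univ.erase i, Real.exp ((Real.exp u - 1) * exceedance (θ j) s) :=
          Finset.prod_le_prod (fun j _ => hnn j) fun j _ => h2 j
      _ ≤ ∏ j, Real.exp ((Real.exp u - 1) * exceedance (θ j) s) :=
          by
            rw [← Real.exp_sum, ← Real.exp_sum, Real.exp_le_exp]
            refine Finset.sum_le_sum_of_subset_of_nonneg (Finset.erase_subset _ _) fun j _ _ => ?_
            have := Real.add_one_le_exp u
            exact mul_nonneg (by linarith) (exceedance_nonneg _ _)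
      _ = _ := by rw [← Real.exp_sum, ← Finset.mul_sum, meanCount]
  have h6 : 0 ≤ ∫ ω, g (X i ω) ∂P := integral_nonneg fun ω => hg0 _
  calc _ ≤ (Real.exp u * ∫ ω, g (X i ω) ∂P) * Real.exp ((Real.exp u - 1) * meanCount θ s) := by
        refine mul_le_mul h1 h5 (Finset.prod_nonneg fun j hj => ?_) (by positivity)
        simp only [Finset.ne_of_mem_erase hj, if_false]
        exact hnn j
    _ = _ := by ring

/-- Upper Chernoff bound for the number of exceedances, weighted by one observation. -/
lemma setIntegral_le_count_le (hX : ∀ i, HasLaw (X i) (gaussianReal (θ i) 1) P)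
    (hind : iIndepFun X P) (s : ℝ) {u : ℝ} (hu : 0 ≤ u) (k : ℕ) (i : Fin n) {g : ℝ → ℝ}
    (hg : Measurable g) (hg0 : ∀ x, 0 ≤ g x) (hgi : Integrable (fun ω => g (X i ω)) P) :
    ∫ ω in {ω | k ≤ count (fun i => X i ω) s}, g (X i ω) ∂P
      ≤ Real.exp u * Real.exp ((Real.exp u - 1) * meanCount θ s - u * k)
        * ∫ ω, g (X i ω) ∂P := by
  have hXm : ∀ j, AEMeasurable (X j) P := fun j => (hX j).aemeasurable
  have hns := nullMeasurableSet_le_count hXm s k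
  have h1 := integral_mul_exp_count_le hX hind s hu i hg hg0 hgi
  have hint : Integrable (fun ω => g (X i ω) * Real.exp (u * count (fun i => X i ω) s)) P := by
    have hm : AEStronglyMeasurable (fun ω => g (X i ω) * Real.exp (u * count (fun i => X i ω) s))
        P := by
      have := aemeasurable_count hXm s
      exact ((hg.comp_aemeasurable (hXm i)).mul (this.const_mul u).exp).aestronglyMeasurable
    refine (hgi.mul_const (Real.exp (u * n))).mono' hm (ae_of_all _ fun ω => ?_)
    rw [Real.norm_of_nonneg (mul_nonneg (hg0 _) (Real.exp_pos _).le)]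
    have hc : (count (fun i => X i ω) s : ℝ) ≤ n := by
      have := Finset.card_filter_le (Finset.univ : Finset (Fin n)) fun i => s ≤ |X i ω|
      rw [Finset.card_univ, Fintype.card_fin] at this
      exact_mod_cast this
    have := hg0 (X i ω)
    gcongr
  rw [← integral_indicator₀ hns]
  calc _ ≤ ∫ ω, Real.exp (-(u * k)) * (g (X i ω) * Real.exp (u * count (fun i => X i ω) s)) ∂P := by
        refine integral_mono_of_nonneg (ae_of_all _ fun ω => Set.indicator_nonneg
          (fun _ _ => hg0 _) _) (hint.const_mul _) (ae_of_all _ fun ω => ?_)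
        simp only
        rw [mul_left_comm, ← Real.exp_add]
        by_cases hω : k ≤ count (fun i => X i ω) s
        · rw [Set.indicator_of_mem (show ω ∈ {ω | k ≤ count (fun i => X i ω) s} from hω)]
          refine le_mul_of_one_le_right (hg0 _) ?_
          rw [Real.one_le_exp_iff]
          have : (k : ℝ) ≤ count (fun i => X i ω) s := by exact_mod_cast hω
          nlinarith
        · rw [Set.indicator_of_notMem (show ω ∉ {ω | k ≤ count (fun i => X i ω) s} from hω)]
          exact mul_nonneg (hg0 _) (Real.exp_pos _).le
    _ ≤ Real.exp (-(u * k)) * (Real.exp u * Real.exp ((Real.exp u - 1) * meanCount θ s)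
          * ∫ ω, g (X i ω) ∂P) := by
        rw [integral_const_mul]
        gcongr
    _ = _ := by
        rw [sub_eq_add_neg _ (u * (k : ℝ)), Real.exp_add]
        ring

/-- Lower Chernoff bound for the number of exceedances. -/
lemma measureReal_count_le (hX : ∀ i, HasLaw (X i) (gaussianReal (θ i) 1) P)
    (hind : iIndepFun X P) (s : ℝ) (k : ℕ) :
    P.real {ω | count (fun i => X i ω) s ≤ k}
      ≤ Real.exp (k - (1 - Real.exp (-1)) * meanCount θ s) := by
  set h : ℝ → ℝ := fun x => Real.exp (-1 * if s ≤ |x| then 1 else 0) with hh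
  have hhm : Measurable h := measurable_exp_indicator (-1) s
  have hXm : ∀ j, AEMeasurable (X j) P := fun j => (hX j).aemeasurable
  have hprod := hind.integral_fun_prod_comp (𝕜 := ℝ) hXm (f := fun _ => h)
    (fun j => hhm.aestronglyMeasurable)
  have hexp : ∀ ω, Real.exp (-count (fun i => X i ω) s) = ∏ j, h (X j ω) := fun ω => by
    rw [count_eq_sum, neg_eq_neg_one_mul, Finset.mul_sum, Real.exp_sum]
  simp_rw [← hexp] at hprod
  have hcm := aemeasurable_count hXm s
  have hint : Integrable (fun ω => Real.exp (-count (fun i => X i ω) s)) P := by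
    refine (integrable_const (1 : ℝ)).mono' hcm.neg.exp.aestronglyMeasurable
      (ae_of_all _ fun ω => ?_)
    rw [Real.norm_of_nonneg (Real.exp_pos _).le, Real.exp_le_one_iff]
    simp
  have h2 := integral_exp_indicator_le hX (-1) s
  have h3 : ∫ ω, Real.exp (-count (fun i => X i ω) s) ∂P
      ≤ Real.exp ((Real.exp (-1) - 1) * meanCount θ s) := by
    rw [hprod, meanCount, Finset.mul_sum, Real.exp_sum]
    exact Finset.prod_le_prod (fun j _ => integral_nonneg fun ω => (Real.exp_pos _).le)
      fun j _ => h2 j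
  have hns : NullMeasurableSet {ω | count (fun i => X i ω) s ≤ k} P := by
    simpa using nullMeasurableSet_le hcm (aemeasurable_const (b := (k : ℝ)))
  rw [← integral_indicator_one_of_nullMeasurable hns]
  calc _ ≤ ∫ ω, Real.exp k * Real.exp (-count (fun i => X i ω) s) ∂P := by
        refine integral_mono_of_nonneg (ae_of_all _ fun ω => Set.indicator_nonneg
          (fun _ _ => zero_le_one) _) (hint.const_mul _) (ae_of_all _ fun ω => ?_)
        simp only
        rw [← Real.exp_add]
        by_cases hω : count (fun i => X i ω) s ≤ k
        · rw [Set.indicator_of_mem (show ω ∈ {ω | count (fun i => X i ω) s ≤ k} from hω),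
            Pi.one_apply, Real.one_le_exp_iff]
          have : (count (fun i => X i ω) s : ℝ) ≤ k := by exact_mod_cast hω
          linarith
        · rw [Set.indicator_of_notMem (show ω ∉ {ω | count (fun i => X i ω) s ≤ k} from hω)]
          exact (Real.exp_pos _).le
    _ ≤ Real.exp k * Real.exp ((Real.exp (-1) - 1) * meanCount θ s) := by
        rw [integral_const_mul]
        gcongr
    _ = _ := by
        rw [← Real.exp_add]
        ring_nf

end Observations

/-! ### Geometric sums, and measurability at random thresholds -/

lemma sum_Icc_half_pow_le (n : ℕ) : ∑ k ∈ Finset.Icc 1 n, (1 / 2 : ℝ) ^ k ≤ 1 := by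
  have h : ∑ k ∈ Finset.Icc 1 n, (1 / 2 : ℝ) ^ k = 1 - (1 / 2) ^ n := by
    induction n with
    | zero => simp
    | succ m ih => rw [Finset.sum_Icc_succ_top (by omega), ih]; ring
  rw [h]
  have : (0 : ℝ) ≤ (1 / 2) ^ n := by positivity
  linarith

lemma measurable_soft_uncurry : Measurable fun p : ℝ × ℝ => soft p.1 p.2 := by
  have hs : Measurable Real.sign := by
    unfold Real.sign
    exact Measurable.ite measurableSet_Iio measurable_const
      (Measurable.ite measurableSet_Ioi measurable_const measurable_const)
  unfold soft
  exact (hs.comp measurable_snd).mul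
    (((measurable_snd.abs).sub measurable_fst).max measurable_const)

lemma aemeasurable_soft {Ω : Type*} [MeasurableSpace Ω] {P : Measure Ω} {l f : Ω → ℝ} (hl : AEMeasurable l P) (hf : AEMeasurable f P) :
    AEMeasurable (fun ω => soft (l ω) (f ω)) P :=
  measurable_soft_uncurry.comp_aemeasurable (hl.prodMk hf)

lemma integrable_sum_soft_noise_sq {n : ℕ} {Ω : Type*} [MeasurableSpace Ω] {P : Measure Ω}
    {θ : Fin n → ℝ} {X : Fin n → Ω → ℝ} (hX : ∀ i, HasLaw (X i) (gaussianReal (θ i) 1) P)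
    {l : Ω → ℝ} (hlm : AEMeasurable l P) (hl : ∀ᵐ ω ∂P, 0 ≤ l ω) :
    Integrable (fun ω => ∑ i, soft (l ω) (X i ω - θ i) ^ 2) P := by
  refine integrable_finsetSum _ fun i _ =>
    (integrable_noise hX i integrable_sq_stdGaussian).mono' ?_ ?_
  · exact ((aemeasurable_soft hlm ((hX i).aemeasurable.sub_const _)).pow_const
      2).aestronglyMeasurable
  · filter_upwards [hl] with ω hω
    rw [Real.norm_of_nonneg (sq_nonneg _)]
    exact soft_sq_le_sq hω

section Observations

variable {n : ℕ} {Ω : Type*} [MeasurableSpace Ω] {P : Measure Ω} [IsProbabilityMeasure P]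
  {θ : Fin n → ℝ} {X : Fin n → Ω → ℝ}

/-! ### The step-down threshold is not too high -/

lemma exists_of_lt_xiHatDown {α t : ℝ} (ht : 0 ≤ t) {x : Fin n → ℝ} (h : t < xiHatDown α x) :
    ∃ k ∈ Finset.Icc 1 n, t < xi α n k ∧ count x (xi α n (k + 1)) ≤ k + 1 := by
  -- The supremum of the empty set is 0 by convention, which `0 ≤ t` excludes.
  have hne : (stepDownSet α x).Nonempty := by
    by_contra hcon
    rw [Set.not_nonempty_iff_eq_empty] at hcon
    rw [xiHatDown, hcon, Real.sSup_empty] at h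
    linarith
  obtain ⟨a, ⟨k, hk1, hkn, hc, rfl⟩, ha⟩ := exists_lt_of_lt_csSup hne h
  exact ⟨k, Finset.mem_Icc.2 ⟨hk1, hkn⟩, ha, hc.le⟩

lemma card_mul_le_meanCount (θ : Fin n → ℝ) (v : ℝ) {s c : ℝ}
    (h : ∀ i, v < |θ i| → c ≤ exceedance (θ i) s) :
    ((Finset.univ.filter fun i => v < |θ i|).card : ℝ) * c ≤ meanCount θ s := by
  rw [meanCount, ← nsmul_eq_mul, ← Finset.sum_const]
  refine (Finset.sum_le_sum fun i hi => h i (Finset.mem_filter.1 hi).2).trans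
    (Finset.sum_le_sum_of_subset_of_nonneg (Finset.filter_subset _ _) fun i _ _ =>
      exceedance_nonneg _ _)

/-- The number of signals above a level, times the probability that the step-down threshold
exceeds this level, is bounded by a multiple of the expected number of null exceedances. -/
lemma card_mul_measureReal_lt_xiHatDown_le
    (hX : ∀ i, HasLaw (X i) (gaussianReal (θ i) 1) P) (hind : iIndepFun X P) (hn : 1 ≤ n)
    {α : ℝ} (hα0 : 0 < α) (hα1 : α < 1) {t v : ℝ} (ht : 0 ≤ t) (htv : t ≤ v) :
    ((Finset.univ.filter fun i => v < |θ i|).card : ℝ)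
        * P.real {ω | t < xiHatDown α (fun i => X i ω)}
      ≤ 32 * n * gaussianTail t / α := by
  set K : ℝ := ((Finset.univ.filter fun i => v < |θ i|).card : ℝ) with hK
  have hn0 : (0 : ℝ) < n := by exact_mod_cast hn
  have hQ := gaussianTail_pos t
  -- `κ` is the real index at which the candidate level equals `t`: a level `ξ_k` above `t` has `k ≤
  -- κ`.
  set κ : ℝ := 2 * n * gaussianTail t / α with hκ
  have hκ0 : 0 < κ := by positivity
  have hgoal : 32 * n * gaussianTail t / α = 16 * κ := by rw [hκ]; ring
  rw [hgoal]
  have hK0 : 0 ≤ K := Nat.cast_nonneg _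
  rcases le_total K (16 * κ) with hc | hc
  · calc K * _ ≤ K * 1 := by gcongr; exact measureReal_le_one
      _ ≤ _ := by linarith
  -- At each relevant level the expected count exceeds `k + 1` by the factor `b`, which is at least
  -- 4 in the remaining case.
  set b : ℝ := K / (4 * κ) with hb
  have hb4 : 4 ≤ b := by rw [hb, le_div_iff₀ (by positivity)]; linarith
  have hlow : ∀ k ∈ Finset.Icc 1 n, t < xi α n k →
      b * (k + 1 : ℕ) ≤ meanCount θ (xi α n (k + 1)) := by
    intro k hk htk
    rw [Finset.mem_Icc] at hk
    have hk1 : (1 : ℝ) ≤ k := by exact_mod_cast hk.1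
    have hkn : (k : ℝ) ≤ n := by exact_mod_cast hk.2
    have hn1 : (1 : ℝ) ≤ n := by exact_mod_cast hn
    have h1 : gaussianTail (xi α n k) = α * k / (2 * n) :=
      gaussianTail_xi hα0 hk.1 hn (by nlinarith)
    have h2 : gaussianTail (xi α n (k + 1)) = α * (k + 1 : ℕ) / (2 * n) :=
      gaussianTail_xi hα0 (by omega) hn (by push_cast; nlinarith)
    have hkκ : (k : ℝ) ≤ κ := by
      have := gaussianTail_antitone htk.le
      rw [h1, div_le_iff₀ (by positivity)] at this
      rw [hκ, le_div_iff₀ hα0]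
      linarith
    have h3 : b * (k + 1 : ℕ) = K * ((k + 1 : ℕ) / (4 * κ)) := by rw [hb]; ring
    rw [h3]
    refine card_mul_le_meanCount θ v fun i hi => ?_
    rcases le_total t (xi α n (k + 1)) with hs | hs
    · refine le_trans ?_ (gaussianTail_div_le_exceedance ht (htv.trans hi.le) hs)
      rw [h2, hκ, div_div, div_le_div_iff₀ (by positivity) (by positivity)]
      have h5 : ((k + 1 : ℕ) : ℝ) * (2 * n * (2 * gaussianTail t))
          ≤ 2 * (((k + 1 : ℕ) : ℝ) * (2 * n * (2 * gaussianTail t))) := by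
        have : 0 ≤ ((k + 1 : ℕ) : ℝ) * (2 * n * (2 * gaussianTail t)) := by positivity
        linarith
      refine h5.trans (le_of_eq ?_)
      field_simp
      norm_num
    -- The next level `ξ_{k+1}` may already lie below `t`. Signals then exceed it with probability
    -- at least `1 / 2`, and `k + 1 ≤ 2 κ`.
    · refine le_trans ?_ (half_le_exceedance (hs.trans (htv.trans hi.le)))
      rw [div_le_div_iff₀ (by positivity) (by norm_num)]
      push_cast
      linarith
  -- Because `b ≥ 4`, the Chernoff exponent `(k + 1) (1 - b / 2)` is at most `-(k + 1) b / 4`. One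
  -- factor `q` is kept to compensate `K`; the others sum the union bound.
  set q : ℝ := Real.exp (-(b / 4)) with hq
  have hq0 : 0 < q := Real.exp_pos _
  have hexp1 : Real.exp (-1) ≤ 1 / 2 := by
    rw [Real.exp_neg, one_div]
    have := Real.add_one_le_exp 1
    exact inv_anti₀ (by norm_num) (by linarith)
  have hq2 : q ≤ 1 / 2 := (Real.exp_le_exp.2 (by linarith)).trans hexp1
  have hterm : ∀ k ∈ Finset.Icc 1 n, t < xi α n k →
      P.real {ω | count (fun i => X i ω) (xi α n (k + 1)) ≤ k + 1} ≤ q * (1 / 2) ^ k := by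
    intro k hk htk
    have h1 := hlow k hk htk
    have h2 := measureReal_count_le hX hind (xi α n (k + 1)) (k + 1)
    refine h2.trans ?_
    calc Real.exp ((k + 1 : ℕ) - (1 - Real.exp (-1)) * meanCount θ (xi α n (k + 1)))
        ≤ Real.exp ((k + 1 : ℕ) * (-(b / 4))) := by
          refine Real.exp_le_exp.2 ?_
          have h3 : 1 / 2 * (b * (k + 1 : ℕ))
              ≤ (1 - Real.exp (-1)) * meanCount θ (xi α n (k + 1)) :=
            mul_le_mul (by linarith) h1 (by positivity) (by linarith)
          have h4 : (0 : ℝ) ≤ (k + 1 : ℕ) := Nat.cast_nonneg _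
          nlinarith
      _ = q * q ^ k := by rw [Real.exp_nat_mul, ← hq, pow_succ']
      _ ≤ _ := by gcongr
  have hP : P.real {ω | t < xiHatDown α (fun i => X i ω)} ≤ q := by
    classical
    set I := (Finset.Icc 1 n).filter fun k => t < xi α n k
    have hsub : {ω | t < xiHatDown α (fun i => X i ω)}
        ⊆ ⋃ k ∈ I, {ω | count (fun i => X i ω) (xi α n (k + 1)) ≤ k + 1} := by
      intro ω hω
      obtain ⟨k, hk, h1, h2⟩ := exists_of_lt_xiHatDown ht hω
      simp only [Set.mem_iUnion]
      exact ⟨k, Finset.mem_filter.2 ⟨hk, h1⟩, h2⟩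
    calc _ ≤ P.real (⋃ k ∈ I, {ω | count (fun i => X i ω) (xi α n (k + 1)) ≤ k + 1}) :=
          measureReal_mono hsub (measure_ne_top _ _)
      _ ≤ ∑ k ∈ I, P.real {ω | count (fun i => X i ω) (xi α n (k + 1)) ≤ k + 1} :=
          measureReal_biUnion_finset_le _ _
      _ ≤ ∑ k ∈ I, q * (1 / 2) ^ k := Finset.sum_le_sum fun k hk =>
          hterm k (Finset.mem_filter.1 hk).1 (Finset.mem_filter.1 hk).2
      _ ≤ ∑ k ∈ Finset.Icc 1 n, q * (1 / 2) ^ k :=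
          Finset.sum_le_sum_of_subset_of_nonneg (Finset.filter_subset _ _)
            fun k _ _ => by positivity
      _ ≤ q * 1 := by
          rw [← Finset.mul_sum]
          gcongr
          exact sum_Icc_half_pow_le n
      _ = q := mul_one q
  have hbq : b * q ≤ 4 := by
    have h1 := Real.add_one_le_exp (b / 4)
    have h2 : q * Real.exp (b / 4) = 1 := by rw [hq, ← Real.exp_add]; simp
    nlinarith
  calc K * _ ≤ K * q := mul_le_mul_of_nonneg_left hP hK0
    _ = 4 * κ * (b * q) := by rw [hb]; field_simp
    _ ≤ 4 * κ * 4 := by gcongr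
    _ = _ := by ring

/-- Layer by layer: raising the cap from `v + j` to `v + j + 1` adds at most `2 (v + j) + 1` to the
square, and nothing unless both `a` and `l` exceed `v + j`. This separates signal counts from events
on the threshold. -/
lemma min_sq_le_add_sum {a l v : ℝ} (ha : 0 ≤ a) (hv : 0 ≤ v) (J : ℕ) :
    min (min a (max l v)) (v + J) ^ 2
      ≤ min a v ^ 2 + ∑ j ∈ Finset.range J,
        (2 * (v + j) + 1) * if v + j < a ∧ v + j < l then 1 else 0 := by
  induction J with
  | zero =>
    simp only [Nat.cast_zero, add_zero, Finset.range_zero, Finset.sum_empty]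
    have : min (min a (max l v)) v = min a v := by
      rw [min_assoc, min_eq_right (le_max_right l v)]
    rw [this]
  | succ J ih =>
    rw [Finset.sum_range_succ, ← add_assoc]
    have hJ : (0 : ℝ) ≤ J := Nat.cast_nonneg J
    set m := min a (max l v) with hm
    have hm0 : 0 ≤ m := le_min ha (hv.trans (le_max_right _ _))
    refine le_trans ?_ (add_le_add_left ih _)
    push_cast
    rcases le_or_gt m (v + J) with h | h
    · rw [min_eq_left h, min_eq_left (by linarith)]
      have : (0 : ℝ) ≤ (2 * (v + J) + 1) * if v + J < a ∧ v + J < l then 1 else 0 := by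
        split_ifs <;> simp
        positivity
      linarith
    · have h1 : v + J < a := h.trans_le (min_le_left _ _)
      have h2 : v + J < max l v := h.trans_le (min_le_right _ _)
      have h3 : v + J < l := by
        rcases lt_max_iff.1 h2 with h3 | h3
        · exact h3
        · linarith
      rw [min_eq_right h.le, if_pos ⟨h1, h3⟩]
      have h4 : min m (v + (J + 1)) ^ 2 ≤ (v + (J + 1)) ^ 2 :=
        pow_le_pow_left₀ (le_min hm0 (by linarith)) (min_le_right _ _) 2
      nlinarith

/-- The bias of a threshold below the step-down level, compared to the bias at a fixed level. -/
lemma integral_sum_min_sq_le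
    (hX : ∀ i, HasLaw (X i) (gaussianReal (θ i) 1) P) (hind : iIndepFun X P) (hn : 1 ≤ n)
    {α : ℝ} (hα0 : 0 < α) (hα1 : α < 1) {c v : ℝ} (hc : 1 ≤ c) (hv : 0 ≤ v)
    {l : Ω → ℝ} (hlm : AEMeasurable l P)
    (hl : ∀ᵐ ω ∂P, l ω ≤ c * xiHatDown α (fun i => X i ω))
    {J : ℕ} (hJ : ∀ i, |θ i| ≤ v + J) :
    ∫ ω, ∑ i, min |θ i| (max (l ω) v) ^ 2 ∂P
      ≤ ∑ i, min |θ i| v ^ 2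
        + 32 * n / α * ∑ j ∈ Finset.range J, (2 * (v + j) + 1) * gaussianTail ((v + j) / c) := by
  have hns : ∀ j : ℕ, NullMeasurableSet {ω | v + j < l ω} P := fun j =>
    nullMeasurableSet_lt aemeasurable_const hlm
  set E : ℕ → Set Ω := fun j => {ω | v + j < l ω} with hE
  set K : ℕ → ℝ := fun j => ((Finset.univ.filter fun i => v + j < |θ i|).card : ℝ) with hK
  have hpath : ∀ ω, ∑ i, min |θ i| (max (l ω) v) ^ 2
      ≤ ∑ i, min |θ i| v ^ 2
        + ∑ j ∈ Finset.range J, (2 * (v + j) + 1) * K j * (E j).indicator (1 : Ω → ℝ) ω := by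
    intro ω
    calc _ ≤ ∑ i, (min |θ i| v ^ 2 + ∑ j ∈ Finset.range J,
        (2 * (v + j) + 1) * if v + j < |θ i| ∧ v + j < l ω then 1 else 0) := by
          refine Finset.sum_le_sum fun i _ => ?_
          have h := min_sq_le_add_sum (a := |θ i|) (l := l ω) (abs_nonneg _) hv J
          rwa [min_eq_left ((min_le_left _ _).trans (hJ i))] at h
      _ = _ := by
          rw [Finset.sum_add_distrib, Finset.sum_comm]
          congr 1
          refine Finset.sum_congr rfl fun j _ => ?_
          rw [← Finset.mul_sum, mul_assoc]
          congr 1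
          by_cases hω : v + j < l ω
          · rw [Set.indicator_of_mem (show ω ∈ E j from hω)]
            simp [hK, hω, Finset.sum_boole]
          · rw [Set.indicator_of_notMem (show ω ∉ E j from hω)]
            simp [hω]
  have hind1 : ∀ j, Integrable ((E j).indicator (1 : Ω → ℝ)) P := fun j =>
    (integrable_const (1 : ℝ)).indicator₀ (hns j)
  have hint2 : Integrable (fun ω => ∑ j ∈ Finset.range J,
      (2 * (v + j) + 1) * K j * (E j).indicator (1 : Ω → ℝ) ω) P :=
    integrable_finsetSum _ fun j _ => (hind1 j).const_mul _
  calc _ ≤ ∫ ω, (∑ i, min |θ i| v ^ 2 + ∑ j ∈ Finset.range J,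
        (2 * (v + j) + 1) * K j * (E j).indicator (1 : Ω → ℝ) ω) ∂P :=
        integral_mono_of_nonneg (ae_of_all _ fun ω => Finset.sum_nonneg fun i _ => sq_nonneg _)
          ((integrable_const _).add hint2) (ae_of_all _ hpath)
    _ = ∑ i, min |θ i| v ^ 2 + ∑ j ∈ Finset.range J,
        (2 * (v + j) + 1) * (K j * P.real (E j)) := by
        rw [integral_add (integrable_const _) hint2,
          integral_finsetSum _ fun j _ => (hind1 j).const_mul _]
        congr 1
        · simp
        · refine Finset.sum_congr rfl fun j _ => ?_
          rw [integral_const_mul, integral_indicator_one_of_nullMeasurable (hns j), mul_assoc]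
    _ ≤ ∑ i, min |θ i| v ^ 2 + ∑ j ∈ Finset.range J,
        (2 * (v + j) + 1) * (32 * n * gaussianTail ((v + j) / c) / α) := by
        gcongr with j hj
        have hc0 : 0 < c := by linarith
        have hvj : 0 ≤ v + j := by positivity
        have h1 := card_mul_measureReal_lt_xiHatDown_le hX hind hn hα0 hα1
          (t := (v + j) / c) (v := v + j) (by positivity) (div_le_self hvj hc)
        refine le_trans ?_ h1
        refine mul_le_mul_of_nonneg_left ?_ (Nat.cast_nonneg _)
        refine ENNReal.toReal_mono (measure_ne_top _ _) (measure_mono_ae ?_)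
        filter_upwards [hl] with ω hω hω'
        change (v + j) / c < _
        rw [div_lt_iff₀ hc0, mul_comm]
        exact lt_of_lt_of_le hω' hω
    _ = _ := by
        rw [Finset.mul_sum]
        congr 1
        refine Finset.sum_congr rfl fun j _ => ?_
        ring

/-! ### The step-up threshold is not too low -/

lemma finite_stepUpSet (α : ℝ) (x : Fin n → ℝ) : (stepUpSet α x).Finite := by
  refine ((Finset.Icc 1 n).finite_toSet.image (xi α n)).subset ?_
  rintro t ⟨k, hk1, hkn, -, rfl⟩
  exact ⟨k, by simp [hk1, hkn], rfl⟩

lemma xiHatUp_cases (α : ℝ) (x : Fin n → ℝ) :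
    xiHatUp α x = xi α n 1 ∨
      ∃ k, 1 ≤ k ∧ k ≤ n ∧ k ≤ count x (xi α n k) ∧ xiHatUp α x = xi α n k := by
  unfold xiHatUp
  split_ifs with h
  · obtain ⟨k, h1, h2, h3, h4⟩ := h.csInf_mem (finite_stepUpSet α x)
    exact Or.inr ⟨k, h1, h2, h3, h4⟩
  · exact Or.inl rfl

lemma xiHatUp_nonneg {α : ℝ} (hα0 : 0 < α) (hα1 : α < 1) (hn : 1 ≤ n) (x : Fin n → ℝ) :
    0 ≤ xiHatUp α x := by
  rcases xiHatUp_cases α x with h | ⟨k, h1, h2, -, h⟩ <;> rw [h]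
  · exact xi_nonneg hα0 hα1 le_rfl hn
  · exact xi_nonneg hα0 hα1 h1 h2

/-- Either the step-up rule stops at an index at most `m` (the default `ξ_1` included) and the first
term suffices, or its index appears in the sum with its defining event. There the inflation `c` is
dropped, the event itself being rare. -/
lemma soft_sq_le_of_xiHatUp_le {α : ℝ} (hα0 : 0 < α) (hα1 : α < 1) {c l : ℝ} (hc : 1 ≤ c)
    {x : Fin n → ℝ} (hl : c * xiHatUp α x ≤ l) {m : ℕ} (hm1 : 1 ≤ m) (hmn : m ≤ n) (z : ℝ) :
    soft l z ^ 2 ≤ soft (c * xi α n m) z ^ 2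
      + ∑ k ∈ Finset.Ioc m n, if k ≤ count x (xi α n k) then soft (xi α n k) z ^ 2 else 0 := by
  have hn : 1 ≤ n := hm1.trans hmn
  have hc0 : 0 ≤ c := by linarith
  have hlt : ∀ k, k ≤ n → α * k < 2 * n := fun k hk => by
    have h1 : (k : ℝ) ≤ n := by exact_mod_cast hk
    have h2 : (1 : ℝ) ≤ n := by exact_mod_cast hn
    have h3 : (0 : ℝ) ≤ k := Nat.cast_nonneg k
    nlinarith
  have hsum : 0 ≤ ∑ k ∈ Finset.Ioc m n,
      if k ≤ count x (xi α n k) then soft (xi α n k) z ^ 2 else 0 :=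
    Finset.sum_nonneg fun k _ => by split_ifs <;> positivity
  have hlow : ∀ k, 1 ≤ k → k ≤ m → xiHatUp α x = xi α n k →
      soft l z ^ 2 ≤ soft (c * xi α n m) z ^ 2 := fun k hk1 hkm h => by
    refine soft_sq_le_soft_sq (mul_nonneg hc0 (xi_nonneg hα0 hα1 hm1 hmn)) (le_trans ?_ hl)
    rw [h]
    exact mul_le_mul_of_nonneg_left (xi_le_xi hα0 hk1 hkm hn (hlt m hmn)) hc0
  rcases xiHatUp_cases α x with h | ⟨k, h1, h2, h3, h⟩
  · have := hlow 1 le_rfl hm1 h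
    linarith
  · rcases le_or_gt k m with hkm | hkm
    · have := hlow k h1 hkm h
      linarith
    · have h4 := Finset.single_le_sum (f := fun k =>
        if k ≤ count x (xi α n k) then soft (xi α n k) z ^ 2 else 0)
        (fun k _ => by split_ifs <;> positivity) (Finset.mem_Ioc.2 ⟨hkm, h2⟩)
      simp only [h3, if_true] at h4
      have h5 : soft l z ^ 2 ≤ soft (xi α n k) z ^ 2 := by
        have h6 := xi_nonneg hα0 hα1 h1 h2
        refine soft_sq_le_soft_sq h6 (le_trans ?_ hl)
        rw [h]
        exact le_mul_of_one_le_left h6 hc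
      have h7 := sq_nonneg (soft (c * xi α n m) z)
      linarith

/-- The noise passing a threshold above the step-up level. -/
lemma integral_sum_soft_noise_sq_le
    (hX : ∀ i, HasLaw (X i) (gaussianReal (θ i) 1) P) (hind : iIndepFun X P)
    {α : ℝ} (hα0 : 0 < α) (hα1 : α < 1) {c : ℝ} (hc : 1 ≤ c) {l : Ω → ℝ}
    (hl : ∀ᵐ ω ∂P, c * xiHatUp α (fun i => X i ω) ≤ l ω)
    {m : ℕ} (hm1 : 1 ≤ m) (hmn : m ≤ n) {a u C : ℝ} (hu : 0 ≤ u)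
    (hC0 : 0 ≤ C) (hC : ∀ s : ℝ, 0 ≤ s → noiseRisk s ≤ C * gaussianTail s)
    (ha : ∀ k, m < k → k ≤ n → meanCount θ (xi α n k) ≤ a * k) :
    ∫ ω, ∑ i, soft (l ω) (X i ω - θ i) ^ 2 ∂P
      ≤ n * noiseRisk (c * xi α n m)
        + C * Real.exp u * ∑ k ∈ Finset.Ioc m n,
          (k : ℝ) * Real.exp (-(u - (Real.exp u - 1) * a) * k) := by
  have hn : 1 ≤ n := hm1.trans hmn
  have hn0 : (0 : ℝ) < n := by exact_mod_cast hn
  have hXm : ∀ j, AEMeasurable (X j) P := fun j => (hX j).aemeasurable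
  have hs0 : 0 ≤ c * xi α n m := mul_nonneg (by linarith) (xi_nonneg hα0 hα1 hm1 hmn)
  set E : ℕ → Set Ω := fun k => {ω | k ≤ count (fun i => X i ω) (xi α n k)} with hE
  have hns : ∀ k, NullMeasurableSet (E k) P := fun k => nullMeasurableSet_le_count hXm _ _
  have hpath : ∀ᵐ ω ∂P, ∑ i, soft (l ω) (X i ω - θ i) ^ 2
      ≤ ∑ i, (soft (c * xi α n m) (X i ω - θ i) ^ 2 + ∑ k ∈ Finset.Ioc m n,
        (E k).indicator (fun ω => soft (xi α n k) (X i ω - θ i) ^ 2) ω) := by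
    filter_upwards [hl] with ω hω
    refine Finset.sum_le_sum fun i _ => ?_
    have h := soft_sq_le_of_xiHatUp_le hα0 hα1 hc hω hm1 hmn (X i ω - θ i)
    simpa [Set.indicator_apply, hE] using h
  have hi1 : ∀ i, Integrable (fun ω => soft (c * xi α n m) (X i ω - θ i) ^ 2) P := fun i =>
    integrable_noise hX i (integrable_soft_sq hs0)
  have hi2 : ∀ i, ∀ k ∈ Finset.Ioc m n,
      Integrable (fun ω => soft (xi α n k) (X i ω - θ i) ^ 2) P := fun i k hk => by
    rw [Finset.mem_Ioc] at hk
    exact integrable_noise hX i (integrable_soft_sq (xi_nonneg hα0 hα1 (by omega) hk.2))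
  have hi3 : ∀ i, ∀ k ∈ Finset.Ioc m n, Integrable
      (fun ω => (E k).indicator (fun ω => soft (xi α n k) (X i ω - θ i) ^ 2) ω) P :=
    fun i k hk => (hi2 i k hk).indicator₀ (hns k)
  have hterm : ∀ i, ∀ k ∈ Finset.Ioc m n,
      ∫ ω, (E k).indicator (fun ω => soft (xi α n k) (X i ω - θ i) ^ 2) ω ∂P
        ≤ C * Real.exp u * ((k : ℝ) * Real.exp (-(u - (Real.exp u - 1) * a) * k)) / n := by
    intro i k hk
    have hk' := Finset.mem_Ioc.1 hk
    have hx0 := xi_nonneg hα0 hα1 (by omega : 1 ≤ k) hk'.2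
    have hg : Measurable fun x => soft (xi α n k) (x - θ i) ^ 2 :=
      (((continuous_soft hx0).comp (continuous_sub_right (θ i))).pow 2).measurable
    have h := setIntegral_le_count_le hX hind (xi α n k) hu k i hg (fun x => sq_nonneg _)
      (hi2 i k hk)
    rw [integral_indicator₀ (hns k)]
    refine h.trans ?_
    rw [integral_noise hX i (f := fun z => soft (xi α n k) z ^ 2)
      (integrable_soft_sq hx0).aestronglyMeasurable]
    have hkn : (k : ℝ) ≤ n := by exact_mod_cast hk'.2
    have hk0 : (0 : ℝ) ≤ k := Nat.cast_nonneg k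
    have hT : gaussianTail (xi α n k) = α * k / (2 * n) :=
      gaussianTail_xi hα0 (by omega) hn (by nlinarith)
    -- One coordinate passes noise of order `k / n` at `ξ_k`; summation over the `n` coordinates
    -- leaves the factor `k`.
    have hσ : ∫ z, soft (xi α n k) z ^ 2 ∂stdGaussian ≤ C * (k / n) := by
      refine (hC _ hx0).trans ?_
      rw [hT]
      gcongr ?_ * ?_
      rw [div_le_div_iff₀ (by positivity) hn0]
      have : 0 ≤ (k : ℝ) * n := by positivity
      nlinarith
    have hmc := ha k hk'.1 hk'.2
    have he : Real.exp ((Real.exp u - 1) * meanCount θ (xi α n k) - u * k)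
        ≤ Real.exp (-(u - (Real.exp u - 1) * a) * k) := by
      refine Real.exp_le_exp.2 ?_
      have h0 : 0 ≤ Real.exp u - 1 := by linarith [Real.add_one_le_exp u]
      have := mul_le_mul_of_nonneg_left hmc h0
      linarith
    calc _ ≤ Real.exp u * Real.exp (-(u - (Real.exp u - 1) * a) * k) * (C * (k / n)) := by
          gcongr
      _ = _ := by ring
  calc _ ≤ ∫ ω, ∑ i, (soft (c * xi α n m) (X i ω - θ i) ^ 2 + ∑ k ∈ Finset.Ioc m n,
        (E k).indicator (fun ω => soft (xi α n k) (X i ω - θ i) ^ 2) ω) ∂P :=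
        integral_mono_of_nonneg (ae_of_all _ fun ω => Finset.sum_nonneg fun i _ => sq_nonneg _)
          (integrable_finsetSum _ fun i _ => (hi1 i).add (integrable_finsetSum _ (hi3 i))) hpath
    _ = ∑ i : Fin n, (noiseRisk (c * xi α n m) + ∑ k ∈ Finset.Ioc m n,
        ∫ ω, (E k).indicator (fun ω => soft (xi α n k) (X i ω - θ i) ^ 2) ω ∂P) := by
        rw [integral_finsetSum]
        swap
        · exact fun i _ => (hi1 i).add (integrable_finsetSum _ (hi3 i))
        refine Finset.sum_congr rfl fun i _ => ?_
        rw [integral_add (hi1 i) (integrable_finsetSum _ (hi3 i)),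
          integral_finsetSum _ (hi3 i), noiseRisk,
          integral_noise hX i (f := fun z => soft (c * xi α n m) z ^ 2)
            (integrable_soft_sq hs0).aestronglyMeasurable]
    _ ≤ ∑ i : Fin n, (noiseRisk (c * xi α n m) + ∑ k ∈ Finset.Ioc m n,
        C * Real.exp u * ((k : ℝ) * Real.exp (-(u - (Real.exp u - 1) * a) * k)) / n) := by
        gcongr with i _ k hk
        exact hterm i k hk
    _ = _ := by
        rw [Finset.sum_const, Finset.card_univ, Fintype.card_fin, nsmul_eq_mul, mul_add,
          ← Finset.sum_div, ← Finset.mul_sum, mul_div_cancel₀ _ hn0.ne']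

/-! ### Decomposition of the risk -/

lemma loss_le {l ε A v : ℝ} (hl : 0 ≤ l) (hε : 0 < ε) (hA : A ≤ v) (x : Fin n → ℝ) :
    loss θ l x ≤ (1 + ε) * ∑ i, min |θ i| (max l v) ^ 2
      + (1 + 1 / ε) * (∑ i, soft l (x i - θ i) ^ 2
        + ∑ i, if A ≤ |θ i| then (x i - θ i) ^ 2 else 0) := by
  rw [loss, ← Finset.sum_add_distrib, Finset.mul_sum, Finset.mul_sum, ← Finset.sum_add_distrib]
  refine Finset.sum_le_sum fun i _ => ?_
  have h := soft_add_sub_sq_le (A := A) hl hε (θ := θ i) (z := x i - θ i)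
    (μ := min |θ i| (max l v))
    (fun h => le_min le_rfl (h.le.trans (hA.trans (le_max_right _ _))))
    (min_le_min_left _ (le_max_left _ _))
  rwa [add_sub_cancel] at h

lemma integrable_sum_min_sq {l : Ω → ℝ} (hlm : AEMeasurable l P) {v : ℝ} (hv : 0 ≤ v) :
    Integrable (fun ω => ∑ i, min |θ i| (max (l ω) v) ^ 2) P := by
  refine integrable_finsetSum _ fun i _ => (integrable_const (|θ i| ^ 2)).mono' ?_
    (ae_of_all _ fun ω => ?_)
  · exact ((aemeasurable_const.min (hlm.max aemeasurable_const)).pow_const 2).aestronglyMeasurable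
  · rw [Real.norm_of_nonneg (sq_nonneg _)]
    exact pow_le_pow_left₀ (le_min (abs_nonneg _) (hv.trans (le_max_right _ _)))
      (min_le_left _ _) 2

lemma integrable_sum_ite_noise_sq (hX : ∀ i, HasLaw (X i) (gaussianReal (θ i) 1) P) (A : ℝ) :
    Integrable (fun ω => ∑ i, if A ≤ |θ i| then (X i ω - θ i) ^ 2 else 0) P := by
  refine integrable_finsetSum _ fun i _ => ?_
  split_ifs
  · exact integrable_noise hX i integrable_sq_stdGaussian
  · exact integrable_const _

lemma integrable_loss (hX : ∀ i, HasLaw (X i) (gaussianReal (θ i) 1) P)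
    {l : Ω → ℝ} (hlm : AEMeasurable l P) (hl : ∀ᵐ ω ∂P, 0 ≤ l ω) :
    Integrable (fun ω => loss θ (l ω) (fun i => X i ω)) P := by
  refine (((integrable_sum_min_sq hlm (θ := θ) le_rfl).const_mul (1 + 1)).add
    (((integrable_sum_soft_noise_sq hX hlm hl).add
      (integrable_sum_ite_noise_sq hX 0)).const_mul (1 + 1 / 1))).mono' ?_ ?_
  · unfold loss
    exact (Finset.aemeasurable_fun_sum _ fun i _ =>
      ((aemeasurable_soft hlm (hX i).aemeasurable).sub_const _).pow_const 2).aestronglyMeasurable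
  · filter_upwards [hl] with ω hω
    rw [Real.norm_of_nonneg (show 0 ≤ loss θ (l ω) fun i => X i ω from
      Finset.sum_nonneg fun i _ => sq_nonneg _)]
    exact loss_le hω one_pos le_rfl _

lemma risk_le (hX : ∀ i, HasLaw (X i) (gaussianReal (θ i) 1) P)
    {l : Ω → ℝ} (hlm : AEMeasurable l P) (hl : ∀ᵐ ω ∂P, 0 ≤ l ω) {ε A v : ℝ} (hε : 0 < ε)
    (hA : A ≤ v) (hv : 0 ≤ v) :
    risk P X θ l ≤ (1 + ε) * ∫ ω, ∑ i, min |θ i| (max (l ω) v) ^ 2 ∂P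
      + (1 + 1 / ε) * (∫ ω, ∑ i, soft (l ω) (X i ω - θ i) ^ 2 ∂P
        + (Finset.univ.filter fun i => A ≤ |θ i|).card) := by
  have h1 := integrable_sum_min_sq (θ := θ) hlm hv
  have h2 := integrable_sum_soft_noise_sq hX hlm hl
  have h3 := integrable_sum_ite_noise_sq hX A
  have h4 : ∫ ω, ∑ i, (if A ≤ |θ i| then (X i ω - θ i) ^ 2 else 0) ∂P
      = (Finset.univ.filter fun i => A ≤ |θ i|).card := by
    rw [integral_finsetSum]
    · rw [Finset.card_filter]
      push_cast
      refine Finset.sum_congr rfl fun i _ => ?_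
      split_ifs
      · rw [integral_noise hX i (f := fun z => z ^ 2)
          integrable_sq_stdGaussian.aestronglyMeasurable, integral_sq_stdGaussian]
      · simp
    · intro i _
      split_ifs
      · exact integrable_noise hX i integrable_sq_stdGaussian
      · exact integrable_const _
  have h23 : Integrable (fun ω => ∑ i, soft (l ω) (X i ω - θ i) ^ 2
      + ∑ i, if A ≤ |θ i| then (X i ω - θ i) ^ 2 else 0) P := h2.add h3
  rw [← h4, ← integral_add h2 h3, ← integral_const_mul, ← integral_const_mul,
    ← integral_add (h1.const_mul _) (h23.const_mul _)]
  refine integral_mono_ae (integrable_loss hX hlm hl)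
    ((h1.const_mul _).add (h23.const_mul _)) ?_
  filter_upwards [hl] with ω hω
  exact loss_le hω hε hA _

end Observations

/-! ### Real analysis -/

/-- Since `(v + j)² ≥ v² + 2 v j`, the bounds `v ≥ 1` and `c² ≤ 2` make each layer smaller by `exp
(-j / 2)`, so the sum has the order of its first term. -/
lemma exists_sum_mul_gaussianTail_le :
    ∃ C : ℝ, 0 < C ∧ ∀ (c v : ℝ) (J : ℕ), 1 ≤ c → c ^ 2 ≤ 2 → 1 ≤ v →
      ∑ j ∈ Finset.range J, (2 * (v + j) + 1) * gaussianTail ((v + j) / c)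
        ≤ C * v * Real.exp (-v ^ 2 / (2 * c ^ 2)) := by
  set q : ℝ := Real.exp (-(1 / 2)) with hq
  have hq0 : 0 < q := Real.exp_pos _
  have hq1 : ‖q‖ < 1 := by
    rw [Real.norm_of_nonneg hq0.le, hq, Real.exp_lt_one_iff]; norm_num
  have hs : Summable fun j : ℕ => 3 * q ^ j + 2 * ((j : ℝ) ^ 1 * q ^ j) :=
    ((summable_geometric_of_norm_lt_one hq1).mul_left 3).add
      ((summable_pow_mul_geometric_of_norm_lt_one 1 hq1).mul_left 2)
  have hnn : ∀ j : ℕ, 0 ≤ 3 * q ^ j + 2 * ((j : ℝ) ^ 1 * q ^ j) := fun j => by positivity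
  refine ⟨(∑' j : ℕ, (3 * q ^ j + 2 * ((j : ℝ) ^ 1 * q ^ j))) + 1,
    add_pos_of_nonneg_of_pos (tsum_nonneg hnn) one_pos, fun c v J hc hc2 hv => ?_⟩
  set E := Real.exp (-v ^ 2 / (2 * c ^ 2)) with hE
  have hE0 : 0 < E := Real.exp_pos _
  have hterm : ∀ j : ℕ, (2 * (v + j) + 1) * gaussianTail ((v + j) / c)
      ≤ v * E * (3 * q ^ j + 2 * ((j : ℝ) ^ 1 * q ^ j)) := fun j => by
    have hj : (0 : ℝ) ≤ j := Nat.cast_nonneg j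
    have h1 : gaussianTail ((v + j) / c) ≤ E * q ^ j := by
      refine (gaussianTail_le_exp (by positivity)).trans ?_
      rw [hE, hq, ← Real.exp_nat_mul, ← Real.exp_add, Real.exp_le_exp, div_pow, ← neg_div,
        div_div, mul_comm (c ^ 2) 2, ← sub_le_iff_le_add', ← sub_div, div_le_iff₀ (by positivity)]
      have h2 : (j : ℝ) * c ^ 2 ≤ j * 2 := by gcongr
      nlinarith
    have h3 : 2 * (v + j) + 1 ≤ v * (3 + 2 * j) := by nlinarith
    calc _ ≤ v * (3 + 2 * j) * (E * q ^ j) := by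
          gcongr
          exact gaussianTail_nonneg _
      _ = _ := by ring
  calc _ ≤ ∑ j ∈ Finset.range J, v * E * (3 * q ^ j + 2 * ((j : ℝ) ^ 1 * q ^ j)) :=
        Finset.sum_le_sum fun j _ => hterm j
    _ ≤ v * E * ∑' j : ℕ, (3 * q ^ j + 2 * ((j : ℝ) ^ 1 * q ^ j)) := by
        rw [← Finset.mul_sum]
        gcongr
        exact hs.sum_le_tsum _ fun j _ => hnn j
    _ ≤ _ := by
        have : 0 ≤ v * E := by positivity
        nlinarith

/-- Half of the exponent pays for convergence of the series; the other half remains as decay in `m`.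
-/
lemma exists_sum_Ioc_mul_exp_le {κ : ℝ} (hκ : 0 < κ) :
    ∃ S : ℝ, 0 < S ∧ ∀ m n : ℕ,
      ∑ k ∈ Finset.Ioc m n, (k : ℝ) * Real.exp (-κ * k) ≤ S * Real.exp (-(κ / 2) * m) := by
  set q : ℝ := Real.exp (-(κ / 2)) with hq
  have hq0 : 0 < q := Real.exp_pos _
  have hq1 : ‖q‖ < 1 := by
    rw [Real.norm_of_nonneg hq0.le, hq, Real.exp_lt_one_iff]; linarith
  have hs := summable_pow_mul_geometric_of_norm_lt_one 1 hq1
  have hnn : ∀ k : ℕ, 0 ≤ (k : ℝ) ^ 1 * q ^ k := fun k => by positivity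
  refine ⟨(∑' k : ℕ, (k : ℝ) ^ 1 * q ^ k) + 1,
    add_pos_of_nonneg_of_pos (tsum_nonneg hnn) one_pos, fun m n => ?_⟩
  have hE0 := Real.exp_pos (-(κ / 2) * m)
  calc _ ≤ ∑ k ∈ Finset.Ioc m n, (k : ℝ) ^ 1 * q ^ k * Real.exp (-(κ / 2) * m) := by
        refine Finset.sum_le_sum fun k hk => ?_
        have hmk : (m : ℝ) ≤ k := by exact_mod_cast (Finset.mem_Ioc.1 hk).1.le
        rw [pow_one, mul_assoc, hq, ← Real.exp_nat_mul, ← Real.exp_add]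
        gcongr
        nlinarith
    _ ≤ (∑' k : ℕ, (k : ℝ) ^ 1 * q ^ k) * Real.exp (-(κ / 2) * m) := by
        rw [← Finset.sum_mul]
        gcongr
        exact hs.sum_le_tsum _ fun k _ => hnn k
    _ ≤ _ := by gcongr; linarith

/-- To first order the exponent is `u (1 - a)`, positive for small `u`. It is the Chernoff rate for
reaching `k` when at most `a k` exceedances are expected. -/
lemma exists_exp_sub_one_mul_lt {a : ℝ} (ha0 : 0 ≤ a) (ha1 : a < 1) :
    ∃ u : ℝ, 0 < u ∧ 0 < u - (Real.exp u - 1) * a := by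
  refine ⟨(1 - a) / 2, by linarith, ?_⟩
  set u := (1 - a) / 2 with hu
  have hu0 : 0 < u := by rw [hu]; linarith
  have h1 := Real.abs_exp_sub_one_sub_id_le (x := u) (by rw [abs_of_pos hu0, hu]; linarith)
  have h2 := (abs_le.1 h1).2
  have h3 : (Real.exp u - 1) * a ≤ (u + u ^ 2) * a := by gcongr; linarith
  have h4 : 0 < u * (1 - a * (1 + u)) := mul_pos hu0 (by rw [hu]; nlinarith)
  nlinarith

lemma eventually_mul_pow_le_exp (K : ℝ) (k : ℕ) {b : ℝ} (hb : 0 < b) :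
    ∀ᶠ x : ℝ in atTop, K * x ^ k ≤ Real.exp (b * x) := by
  have h := ((isLittleO_pow_exp_pos_mul_atTop k hb).const_mul_left K).bound one_pos
  filter_upwards [h] with x hx
  rw [one_mul, Real.norm_of_nonneg (Real.exp_pos _).le] at hx
  exact (le_abs_self _).trans hx

lemma tendsto_log_natCast : Tendsto (fun n : ℕ => Real.log n) atTop atTop :=
  Real.tendsto_log_atTop.comp tendsto_natCast_atTop_atTop

/-- Size of the level `ξ_m`, for `m` of order `d log n + log log n`. -/
lemma sqrt_log_le_xi {α B CM d : ℝ} {n m : ℕ} (hα0 : 0 < α) (hα1 : α < 1) (hB : 0 < B)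
    (hCM0 : 0 < CM) (hCM : ∀ t : ℝ, 1 ≤ t → Real.exp (-t ^ 2 / 2) ≤ CM * t * gaussianTail t)
    (hd0 : 0 ≤ d) (hd1 : d ≤ 1) (hn : 1 ≤ n) (hm1 : 1 ≤ m)
    (hm : (m : ℝ) ≤ B * (d * Real.log n + Real.log (Real.log n)))
    (hl1 : 1 ≤ Real.log n) (hll0 : 0 ≤ Real.log (Real.log n)) (hlα : Real.log (2 / α) ≤ Real.log n)
    (hb1 : B / gaussianTail 1 * Real.log n ≤ n) (hb2 : B * Real.log n ≤ n)
    (hb3 : 2 * (CM * B) * Real.log n ^ 2 ≤ Real.exp (1 / 2 * Real.log n)) :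
    Real.sqrt (Real.log n) ≤ xi α n m ∧ Real.exp (-xi α n m ^ 2 / 2)
      ≤ CM * B * ((d * Real.log n + Real.log (Real.log n)) * Real.sqrt (Real.log n)) / n := by
  have hn0 : (0 : ℝ) < n := by exact_mod_cast hn
  have hQ1 := gaussianTail_pos 1
  set ℓ := Real.log n with hℓ
  have hexpℓ : Real.exp ℓ = n := Real.exp_log hn0
  have hℓ0 : 0 < ℓ := by linarith
  have hll : Real.log ℓ ≤ ℓ - 1 := Real.log_le_sub_one_of_pos hℓ0
  set w := d * ℓ + Real.log ℓ with hw
  have hw0 : 0 ≤ w := by positivity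
  have hw2 : w ≤ 2 * ℓ := by
    have : d * ℓ ≤ 1 * ℓ := by gcongr
    linarith
  have hm2 : (m : ℝ) ≤ 2 * (B * ℓ) := by
    have : B * w ≤ B * (2 * ℓ) := by gcongr
    linarith
  have hm0 : (1 : ℝ) ≤ m := by exact_mod_cast hm1
  have hαm' : α * m ≤ m := by nlinarith
  have hαm : α * m < 2 * n := by nlinarith
  set x := xi α n m with hx
  have hT : gaussianTail x = α * m / (2 * n) := gaussianTail_xi hα0 hm1 hn hαm
  have hx1 : 1 ≤ x := by
    rw [← gaussianTail_strictAnti.le_iff_ge, hT, div_le_iff₀ (by positivity)]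
    rw [div_mul_eq_mul_div, div_le_iff₀ hQ1] at hb1
    linarith
  have hx0 : 0 < x := by linarith
  set s := Real.sqrt ℓ with hs
  have hs2 : s ^ 2 = ℓ := Real.sq_sqrt hℓ0.le
  have hs1 : 1 ≤ s := Real.one_le_sqrt.2 hl1
  -- This crude upper bound controls the factor `x` in the Mills bound; the resulting estimate of
  -- `exp (-x² / 2)` then returns the lower bound on `x`.
  have hxs : x ≤ 2 * s := by
    have h1 : α / (2 * n) ≤ Real.exp (-x ^ 2 / 2) := by
      refine le_trans ?_ (gaussianTail_le_exp hx0.le)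
      rw [hT]
      gcongr
      exact le_mul_of_one_le_right hα0.le hm0
    have h2 : Real.log (α / (2 * n)) = -(Real.log (2 / α) + ℓ) := by
      rw [hℓ, ← Real.log_mul (by positivity) hn0.ne', ← Real.log_inv]
      congr 1
      field_simp
    have h3 := Real.log_le_log (by positivity) h1
    rw [Real.log_exp, h2] at h3
    refine (abs_le_of_sq_le_sq' (a := x) ?_ (by positivity)).2
    rw [mul_pow, hs2]
    linarith
  have hh : Real.exp (-x ^ 2 / 2) ≤ CM * B * (w * s) / n := by
    calc Real.exp (-x ^ 2 / 2) ≤ CM * x * gaussianTail x := hCM x hx1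
      _ ≤ CM * (2 * s) * (1 * (B * w) / (2 * n)) := by
          rw [hT]; gcongr
      _ = CM * B * (w * s) / n := by field_simp
  refine ⟨?_, hh⟩
  have hsℓ : s ≤ ℓ := by rw [← hs2]; nlinarith
  have h1 : CM * B * (w * s) ≤ 2 * (CM * B) * ℓ ^ 2 := by
    calc CM * B * (w * s) ≤ CM * B * (2 * ℓ * ℓ) := by gcongr
      _ = _ := by ring
  have h2 : Real.exp (-x ^ 2 / 2) ≤ Real.exp (1 / 2 * ℓ - ℓ) := by
    refine hh.trans ?_
    rw [Real.exp_sub, hexpℓ]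
    gcongr
    exact h1.trans hb3
  rw [Real.exp_le_exp] at h2
  refine (abs_le_of_sq_le_sq' (a := s) ?_ hx0.le).2
  rw [hs2]
  linarith

/-- Inflating the level by `√(1 + d)` raises `exp (-x² / 2)` to the power `1 + d`. This accounts for
the exponent in `L0` and for the denominator `n ^ d`. -/
lemma noiseRisk_sqrt_mul_le_L0 {K d x : ℝ} {n : ℕ} (hK1 : 1 ≤ K) (hd0 : 0 ≤ d) (hd1 : d ≤ 1)
    (hn : 1 ≤ n) (hl1 : 1 ≤ Real.log n) (hll0 : 0 ≤ Real.log (Real.log n))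
    (hsx : Real.sqrt (Real.log n) ≤ x)
    (hh : Real.exp (-x ^ 2 / 2)
      ≤ K * ((d * Real.log n + Real.log (Real.log n)) * Real.sqrt (Real.log n)) / n) :
    n * noiseRisk (Real.sqrt (1 + d) * x) ≤ 4 * K ^ 2 * (L0 d n / (n : ℝ) ^ d) := by
  have hn0 : (0 : ℝ) < n := by exact_mod_cast hn
  have hK0 : 0 < K := by linarith
  set ℓ := Real.log n with hℓ
  have hℓ0 : 0 < ℓ := by linarith
  set s := Real.sqrt ℓ with hs
  have hs2 : s ^ 2 = ℓ := Real.sq_sqrt hℓ0.le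
  have hs1 : 1 ≤ s := Real.one_le_sqrt.2 hl1
  have hx0 : 0 < x := by linarith
  have hℓ32 : ℓ ^ (3 / 2 : ℝ) = ℓ * s := by
    rw [hs, Real.sqrt_eq_rpow, ← Real.rpow_one_add' hℓ0.le (by norm_num)]
    norm_num
  set Y := d * ℓ ^ (3 / 2 : ℝ) + Real.log ℓ * s with hY
  have hY' : (d * ℓ + Real.log ℓ) * s = Y := by rw [hY, hℓ32]; ring
  rw [hY'] at hh
  have hY0 : 0 ≤ Y := by positivity
  set l := Real.sqrt (1 + d) * x with hl
  have hsd : 1 ≤ Real.sqrt (1 + d) := Real.one_le_sqrt.2 (by linarith)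
  have hxl : x ≤ l := le_mul_of_one_le_left hx0.le hsd
  have hl2 : l ^ 2 = (1 + d) * x ^ 2 := by rw [hl, mul_pow, Real.sq_sqrt (by linarith)]
  have hl0 : 0 < l := hx0.trans_le hxl
  have hpow : Real.exp (-l ^ 2 / 2) ≤ K ^ 2 * Y ^ (1 + d) / (n : ℝ) ^ (1 + d) := by
    have h1 : Real.exp (-l ^ 2 / 2) = Real.exp (-x ^ 2 / 2) ^ (1 + d) := by
      rw [← Real.exp_mul, hl2]; ring_nf
    rw [h1]
    calc _ ≤ (K * Y / n) ^ (1 + d) :=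
          Real.rpow_le_rpow (Real.exp_pos _).le hh (by linarith)
      _ = K ^ (1 + d) * Y ^ (1 + d) / (n : ℝ) ^ (1 + d) := by
          rw [Real.div_rpow (by positivity) hn0.le, Real.mul_rpow hK0.le hY0]
      _ ≤ K ^ (2 : ℝ) * Y ^ (1 + d) / (n : ℝ) ^ (1 + d) := by
          have := Real.rpow_le_rpow_of_exponent_le hK1 (by linarith : 1 + d ≤ 2)
          gcongr
      _ = _ := by rw [Real.rpow_two]
  have hs3 : ℓ ^ (-(3 / 2) : ℝ) = 1 / s ^ 3 := by
    rw [Real.rpow_neg hℓ0.le, hℓ32, ← hs2, one_div]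
    ring_nf
  have hn1d : (n : ℝ) ^ (1 + d) = n * (n : ℝ) ^ d := Real.rpow_one_add' hn0.le (by linarith)
  have h3 : s ≤ l := hsx.trans hxl
  calc n * noiseRisk l ≤ n * (4 * Real.exp (-l ^ 2 / 2) / l ^ 3) := by
        gcongr
        exact noiseRisk_le_exp hl0
    _ ≤ n * (4 * (K ^ 2 * Y ^ (1 + d) / (n : ℝ) ^ (1 + d)) / s ^ 3) := by gcongr
    _ = 4 * K ^ 2 * (1 / s ^ 3 * Y ^ (1 + d) / (n : ℝ) ^ d) := by
        rw [hn1d]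
        have : (0 : ℝ) < (n : ℝ) ^ d := Real.rpow_pos_of_pos hn0 d
        field_simp
    _ = _ := by rw [← hs3, L0]

/-- The noise passing the level `√(1+δ) ξ_m`, for `m` of order `δ log n + log log n`. -/
lemma exists_eventually_noiseRisk_le_L0 {α : ℝ} (hα0 : 0 < α) (hα1 : α < 1) {δ : ℕ → ℝ}
    (hδ0 : ∀ n, 0 ≤ δ n) (hδ : Tendsto δ atTop (𝓝 0)) {B : ℝ} (hB : 0 < B) :
    ∃ C : ℝ, 0 < C ∧ ∀ᶠ n : ℕ in atTop, ∀ m : ℕ, 1 ≤ m →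
      (m : ℝ) ≤ B * (δ n * Real.log n + Real.log (Real.log n)) →
      n * noiseRisk (Real.sqrt (1 + δ n) * xi α n m) ≤ C * (L0 (δ n) n / (n : ℝ) ^ (δ n)) := by
  obtain ⟨CM, hCM0, hCM⟩ := exp_le_mul_gaussianTail
  have hK1 : 1 ≤ max (CM * B) 1 := le_max_right _ _
  refine ⟨4 * max (CM * B) 1 ^ 2, by positivity, ?_⟩
  have hlog := tendsto_log_natCast
  filter_upwards [hδ.eventually_le_const one_pos, hlog.eventually_ge_atTop (Real.log (2 / α)),
    hlog.eventually_ge_atTop 1, (Real.tendsto_log_atTop.comp hlog).eventually_ge_atTop 0,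
    hlog.eventually (eventually_mul_pow_le_exp (B / gaussianTail 1) 1 one_pos),
    hlog.eventually (eventually_mul_pow_le_exp B 1 one_pos),
    hlog.eventually (eventually_mul_pow_le_exp (2 * (CM * B)) 2 (half_pos one_pos)),
    eventually_ge_atTop 1] with n hd1 hlα hl1 hll0 hb1 hb2 hb3 hn m hm1 hm
  have hn0 : (0 : ℝ) < n := by exact_mod_cast hn
  rw [one_mul, Real.exp_log hn0, pow_one] at hb1 hb2
  obtain ⟨h1, h2⟩ := sqrt_log_le_xi hα0 hα1 hB hCM0 hCM (hδ0 n) hd1 hn hm1 hm hl1 hll0 hlα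
    hb1 hb2 hb3
  refine noiseRisk_sqrt_mul_le_L0 hK1 (hδ0 n) hd1 hn hl1 hll0 h1 (h2.trans ?_)
  have h3 : 0 ≤ (δ n * Real.log n + Real.log (Real.log n)) * Real.sqrt (Real.log n) :=
    mul_nonneg (add_nonneg (mul_nonneg (hδ0 n) (by linarith)) hll0) (Real.sqrt_nonneg _)
  gcongr
  exact le_max_left _ _

/-- Exponentially small terms are negligible against `L0`. -/
lemma eventually_exp_neg_le_L0 {δ : ℕ → ℝ} (hδ0 : ∀ n, 0 ≤ δ n) :
    ∀ᶠ n : ℕ in atTop, 0 < L0 (δ n) n / (n : ℝ) ^ (δ n) ∧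
      Real.exp (-(2 * (δ n * Real.log n + Real.log (Real.log n))))
        ≤ L0 (δ n) n / (n : ℝ) ^ (δ n) := by
  have hlog := tendsto_log_natCast
  filter_upwards [hlog.eventually_ge_atTop 1,
    (Real.tendsto_log_atTop.comp hlog).eventually_ge_atTop 1,
    eventually_ge_atTop 1] with n hl1 hll1 hn
  have hn0 : (0 : ℝ) < n := by exact_mod_cast hn
  have hd0 := hδ0 n
  set d := δ n
  set ℓ := Real.log n with hℓ
  simp only [Function.comp_apply] at hll1
  have hℓ0 : 0 < ℓ := by linarith
  have hnd : (n : ℝ) ^ d = Real.exp (d * ℓ) := by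
    rw [Real.rpow_def_of_pos hn0, mul_comm]
  have hs1 : 1 ≤ Real.sqrt ℓ := Real.one_le_sqrt.2 hl1
  have hbase : 1 ≤ d * ℓ ^ (3 / 2 : ℝ) + Real.log ℓ * Real.sqrt ℓ := by
    have : 0 ≤ d * ℓ ^ (3 / 2 : ℝ) := by positivity
    nlinarith
  have hL : ℓ ^ (-(2 : ℝ)) ≤ L0 d n := by
    rw [L0]
    calc ℓ ^ (-(2 : ℝ)) ≤ ℓ ^ (-(3 / 2) : ℝ) * 1 := by
          rw [mul_one]
          exact Real.rpow_le_rpow_of_exponent_le hl1 (by norm_num)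
      _ ≤ _ := by
          gcongr
          exact Real.one_le_rpow hbase (by linarith)
  -- The constant 2 gives `(log n)⁻² n^(-2d)`, smaller than the required `(log n)^(-3/2) n^(-d)`.
  have hexp : Real.exp (-(2 * (d * ℓ + Real.log ℓ)))
      = ℓ ^ (-(2 : ℝ)) * Real.exp (-(2 * (d * ℓ))) := by
    rw [Real.rpow_def_of_pos hℓ0, ← Real.exp_add]
    ring_nf
  have hle : Real.exp (-(2 * (d * ℓ + Real.log ℓ))) ≤ L0 d n / (n : ℝ) ^ d := by
    rw [hexp, hnd, div_eq_mul_inv, ← Real.exp_neg]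
    have h2 : 0 ≤ d * ℓ := by positivity
    have h3 : 0 ≤ ℓ ^ (-(2 : ℝ)) := by positivity
    exact mul_le_mul hL (Real.exp_le_exp.2 (by linarith)) (Real.exp_pos _).le (h3.trans hL)
  exact ⟨(Real.exp_pos _).trans_le hle, hle⟩

/-! ### Bias and noise along a sequence of near-optimal levels -/

section Asymptotics

/-- The truncated squared signal, the first order of the risk at level `l`. -/
noncomputable def truncatedSignal {n : ℕ} (θ : Fin n → ℝ) (l : ℝ) : ℝ := ∑ i, min |θ i| l ^ 2

lemma truncatedSignal_nonneg {n : ℕ} (θ : Fin n → ℝ) (l : ℝ) : 0 ≤ truncatedSignal θ l :=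
  Finset.sum_nonneg fun _ _ => sq_nonneg _

lemma card_le_truncatedSignal {n : ℕ} (θ : Fin n → ℝ) {A l : ℝ} (hA : 0 ≤ A) (hl : A ≤ l) :
    ((Finset.univ.filter fun i => A ≤ |θ i|).card : ℝ) * A ^ 2 ≤ truncatedSignal θ l := by
  rw [truncatedSignal, ← nsmul_eq_mul, ← Finset.sum_const]
  refine (Finset.sum_le_sum fun i hi => ?_).trans
    (Finset.sum_le_sum_of_subset_of_nonneg (Finset.filter_subset _ _) fun i _ _ => sq_nonneg _)
  exact pow_le_pow_left₀ hA (le_min (Finset.mem_filter.1 hi).2 hl) 2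

lemma truncatedSignal_mul_le {n : ℕ} (θ : Fin n → ℝ) {b l : ℝ} (hb : 1 ≤ b) (hl : 0 ≤ l) :
    truncatedSignal θ (b * l) ≤ b ^ 2 * truncatedSignal θ l := by
  rw [truncatedSignal, truncatedSignal, Finset.mul_sum]
  refine Finset.sum_le_sum fun i _ => ?_
  have hb0 : 0 ≤ b := by linarith
  rw [← mul_pow]
  refine pow_le_pow_left₀ (le_min (abs_nonneg _) (mul_nonneg hb0 hl)) ?_ 2
  rw [mul_min_of_nonneg _ _ hb0]
  exact min_le_min_right _ (le_mul_of_one_le_left (abs_nonneg _) hb)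

lemma mul_noiseRisk_le_sum_coordRisk {n : ℕ} (θ : Fin n → ℝ) {l : ℝ} (hl : 0 ≤ l) :
    n * (noiseRisk l / 2) ≤ ∑ i, coordRisk l (θ i) := by
  calc n * (noiseRisk l / 2) = ∑ _i : Fin n, noiseRisk l / 2 := by simp
    _ ≤ _ := Finset.sum_le_sum fun i _ => noiseRisk_le_coordRisk hl _

/-- The candidate levels are calibrated so that pure noise contributes exactly `α k` expected
exceedances; the signals add only their excess. -/
lemma meanCount_xi_le {n k : ℕ} (θ : Fin n → ℝ) {α b l : ℝ} (hα0 : 0 < α) (hα1 : α < 1)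
    (hk : 1 ≤ k) (hkn : k ≤ n)
    (hb : ∀ i, exceedance (θ i) (xi α n k) - exceedance 0 (xi α n k) ≤ b * min |θ i| l ^ 2) :
    meanCount θ (xi α n k) ≤ α * k + b * truncatedSignal θ l := by
  have hk0 : (0 : ℝ) < k := by exact_mod_cast hk
  have hkn' : (k : ℝ) ≤ n := by exact_mod_cast hkn
  have hn0 : (0 : ℝ) < n := hk0.trans_le hkn'
  have hαk : α * k < k := by nlinarith
  have hT : gaussianTail (xi α n k) = α * k / (2 * n) :=
    gaussianTail_xi hα0 hk (hk.trans hkn) (by linarith)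
  have hxpos : 0 < xi α n k := by
    rw [← gaussianTail_strictAnti.lt_iff_gt, hT, gaussianTail_zero,
      div_lt_div_iff₀ (by positivity) two_pos]
    linarith
  have hnull : ∑ _i : Fin n, exceedance 0 (xi α n k) = α * k := by
    rw [exceedance_zero hxpos, hT, Finset.sum_const, Finset.card_univ, Fintype.card_fin,
      nsmul_eq_mul]
    field_simp
  rw [← hnull, truncatedSignal, Finset.mul_sum, ← Finset.sum_add_distrib, meanCount]
  exact Finset.sum_le_sum fun i _ => by linarith [hb i]

/-- Below the level `ξ_m` fewer than `a k` exceedances of `ξ_k` are expected. -/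
lemma meanCount_xi_le_mul {n m k : ℕ} (θ : Fin n → ℝ) {α a l τ T C : ℝ} (hα0 : 0 < α)
    (hα1 : α < 1) (hαa : α < a) (hC0 : 0 < C)
    (hτ : ∀ θ t : ℝ, T ≤ t → exceedance θ t - exceedance 0 t ≤ τ * min |θ| l ^ 2)
    (hC : ∀ θ t : ℝ, exceedance θ t - exceedance 0 t ≤ C * min |θ| l ^ 2)
    (hm : τ / (a - α) * truncatedSignal θ l ≤ m)
    (hM : truncatedSignal θ l ≤ (a - α) * (2 * gaussianTail T / α) / C * n)
    (hmk : m < k) (hkn : k ≤ n) : meanCount θ (xi α n k) ≤ a * k := by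
  have hk1 : 1 ≤ k := by omega
  have hk0 : (0 : ℝ) < k := by exact_mod_cast hk1
  have hkn' : (k : ℝ) ≤ n := by exact_mod_cast hkn
  have hn0 : (0 : ℝ) < n := hk0.trans_le hkn'
  have hmk' : (m : ℝ) ≤ k := by exact_mod_cast hmk.le
  have hαk : α * k < k := by nlinarith
  have hαa0 : 0 < a - α := by linarith
  -- Above `T` the small constant `τ` applies and `k > m` absorbs the excess. Below `T` the index
  -- `k` is at least a fixed fraction of `n`, which absorbs even the crude constant `C`.
  rcases le_or_gt T (xi α n k) with hTk | hTk
  · have h5 := meanCount_xi_le θ hα0 hα1 hk1 hkn fun i => hτ (θ i) _ hTk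
    rw [div_mul_eq_mul_div, div_le_iff₀ hαa0] at hm
    have h8 : (m : ℝ) * (a - α) ≤ k * (a - α) := by gcongr
    linarith
  · have h5 := meanCount_xi_le θ hα0 hα1 hk1 hkn fun i => hC (θ i) _
    have h6 := gaussianTail_strictAnti hTk
    rw [gaussianTail_xi hα0 hk1 (hk1.trans hkn) (by linarith), lt_div_iff₀ (by positivity)] at h6
    have h7 : C * truncatedSignal θ l ≤ (a - α) * (2 * gaussianTail T / α * n) := by
      rw [div_mul_eq_mul_div, le_div_iff₀ hC0] at hM
      linarith
    have h8 : 2 * gaussianTail T / α * n ≤ k := by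
      rw [div_mul_eq_mul_div, div_le_iff₀ hα0]
      linarith
    have h9 : (a - α) * (2 * gaussianTail T / α * n) ≤ (a - α) * k := by gcongr
    linarith

variable {θ : ∀ n, Fin n → ℝ} {L : ℕ → ℝ}

/-- Levels whose risk is of smaller order than `n` tend to infinity. -/
lemma tendsto_level (hL : ∀ n, 0 ≤ L n)
    (hR : (fun n => ∑ i, coordRisk (L n) (θ n i)) =o[atTop] fun n : ℕ => (n : ℝ)) :
    Tendsto L atTop atTop := by
  refine tendsto_atTop.2 fun b => ?_
  set B := max b 0
  have hB : 0 ≤ B := le_max_right _ _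
  have hpos := noiseRisk_pos hB
  filter_upwards [hR.bound (show 0 < noiseRisk B / 4 by positivity), eventually_ge_atTop 1]
    with n hn hn1
  have hn0 : (0 : ℝ) < n := by exact_mod_cast hn1
  have h1 := mul_noiseRisk_le_sum_coordRisk (θ n) (hL n)
  have h2 := h1.trans ((le_abs_self _).trans hn)
  rw [Real.norm_of_nonneg hn0.le, mul_comm] at h2
  have h3 : noiseRisk (L n) / 2 ≤ noiseRisk B / 4 := le_of_mul_le_mul_right h2 hn0
  by_contra hcon
  have h4 : L n ≤ B := (not_le.1 hcon).le.trans (le_max_left _ _)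
  have := noiseRisk_antitoneOn (hL n) hB h4
  linarith

lemma eventually_truncatedSignal_le (hLt : Tendsto L atTop atTop) {ε : ℝ} (hε : 0 < ε) :
    ∀ᶠ n in atTop, (1 - ε) * truncatedSignal (θ n) (L n) ≤ ∑ i, coordRisk (L n) (θ n i) := by
  obtain ⟨B, hB⟩ := exists_le_coordRisk hε
  filter_upwards [hLt.eventually_ge_atTop B] with n hn
  rw [truncatedSignal, Finset.mul_sum]
  exact Finset.sum_le_sum fun i _ => hB _ _ hn

variable {Ω : ℕ → Type*} [∀ n, MeasurableSpace (Ω n)]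
  {P : ∀ n, Measure (Ω n)} [∀ n, IsProbabilityMeasure (P n)]
  {X : ∀ n, Fin n → Ω n → ℝ} {lam : ∀ n, Ω n → ℝ}

/-- A threshold below the step-down level costs asymptotically no more bias than the level `L`. -/
lemma eventually_integral_truncatedSignal_le
    (hX : ∀ n i, HasLaw (X n i) (gaussianReal (θ n i) 1) (P n))
    (hindep : ∀ n, iIndepFun (X n) (P n)) {α : ℝ} (hα0 : 0 < α) (hα1 : α < 1) {δ : ℕ → ℝ}
    (hδ0 : ∀ n, 0 ≤ δ n) (hδ : Tendsto δ atTop (𝓝 0))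
    (hlm : ∀ n, AEMeasurable (lam n) (P n))
    (hlam : ∀ n, 1 ≤ n → ∀ᵐ ω ∂(P n),
      lam n ω ≤ Real.sqrt (1 + δ n) * xiHatDown α (fun i => X n i ω))
    (hLt : Tendsto L atTop atTop) {ε : ℝ} (hε : 0 < ε) (hε1 : ε ≤ 1) :
    ∀ᶠ n in atTop,
      ∫ ω, ∑ i, min |θ n i| (max (lam n ω) ((1 + ε) * L n)) ^ 2 ∂(P n)
        ≤ (1 + ε) ^ 2 * truncatedSignal (θ n) (L n)
          + ε * ∑ i, coordRisk (L n) (θ n i) := by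
  obtain ⟨C, hC0, hC⟩ := exists_sum_mul_gaussianTail_le
  obtain ⟨c₀, hc₀, hc⟩ := exists_le_noiseRisk
  have hsmall : ∀ᶠ n in atTop, 128 * C / (α * c₀ * ε) * L n ^ 1 ≤ Real.exp (2 * L n) :=
    hLt.eventually (eventually_mul_pow_le_exp _ 1 two_pos)
  filter_upwards [hsmall, hLt.eventually_ge_atTop 1, hLt.eventually_ge_atTop (8 / ε),
    hδ.eventually_le_const hε, eventually_ge_atTop 1] with n h1 hL1 hL8 hd hn
  have hn0 : (0 : ℝ) < n := by exact_mod_cast hn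
  have hd0 := hδ0 n
  set l := L n
  set v := (1 + ε) * l with hv
  have hl0 : 0 < l := by linarith
  have hv1 : 1 ≤ v := by nlinarith
  have hv2 : v ≤ 2 * l := by rw [hv]; gcongr; linarith
  set c := Real.sqrt (1 + δ n) with hcdef
  have hc1 : 1 ≤ c := Real.one_le_sqrt.2 (by linarith)
  have hc2 : c ^ 2 = 1 + δ n := Real.sq_sqrt (by linarith)
  -- Enough layers to cover every signal; the bound on the layer sum does not depend on `J`.
  obtain ⟨J, hJ⟩ := exists_nat_ge (∑ i, |θ n i|)
  have hJ' : ∀ i, |θ n i| ≤ v + J := fun i => by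
    have := Finset.single_le_sum (f := fun i => |θ n i|) (fun i _ => abs_nonneg _)
      (Finset.mem_univ i)
    linarith
  have h2 := integral_sum_min_sq_le (hX n) (hindep n) hn hα0 hα1 hc1 (by linarith) (hlm n)
    (hlam n hn) hJ'
  refine h2.trans (add_le_add (truncatedSignal_mul_le _ (by linarith) hl0.le) ?_)
  have h3 := hC c v J hc1 (by rw [hc2]; linarith) hv1
  have h4 := mul_noiseRisk_le_sum_coordRisk (θ n) hl0.le
  -- As `c² ≤ 1 + ε`, the quotient `v² / c²` is at least `(1 + ε) l²`, and the surplus `ε l² / 2`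
  -- exceeds `4 l` once `ε l ≥ 8`.
  have hexp : Real.exp (-v ^ 2 / (2 * c ^ 2))
      ≤ Real.exp (-l ^ 2 / 2 - 2 * l) * Real.exp (-(2 * l)) := by
    rw [← Real.exp_add, Real.exp_le_exp, div_le_iff₀ (by positivity), hc2, hv]
    rw [div_le_iff₀ hε] at hL8
    have h5 : (-l ^ 2 / 2 - 2 * l + -(2 * l)) * (2 * (1 + ε))
        ≤ (-l ^ 2 / 2 - 2 * l + -(2 * l)) * (2 * (1 + δ n)) :=
      mul_le_mul_of_nonpos_left (by linarith) (by nlinarith)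
    refine le_trans ?_ h5
    have h6 : 8 * l ≤ l * ε * l := by gcongr
    have h7 : ((1 + ε) * l) ^ 2 = (1 + ε) * (l ^ 2 + l * ε * l) := by ring
    rw [neg_le, h7]
    have h8 : -((-l ^ 2 / 2 - 2 * l + -(2 * l)) * (2 * (1 + ε)))
        = (1 + ε) * (l ^ 2 + 8 * l) := by ring
    rw [h8]
    gcongr
  have hk : 64 * C * l / α ≤ ε * (c₀ / 2) * Real.exp (2 * l) := by
    rw [pow_one, div_mul_eq_mul_div, div_le_iff₀ (by positivity)] at h1
    rw [div_le_iff₀ hα0]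
    nlinarith
  have hE := Real.exp_pos (-(2 * l))
  have hE2 : Real.exp (2 * l) * Real.exp (-(2 * l)) = 1 := by rw [← Real.exp_add]; simp
  calc 32 * n / α * ∑ j ∈ Finset.range J, (2 * (v + j) + 1) * gaussianTail ((v + j) / c)
      ≤ 32 * n / α * (C * (2 * l) * (Real.exp (-l ^ 2 / 2 - 2 * l) * Real.exp (-(2 * l)))) := by
        refine mul_le_mul_of_nonneg_left (h3.trans ?_) (by positivity)
        gcongr
    _ = n * Real.exp (-l ^ 2 / 2 - 2 * l) * Real.exp (-(2 * l)) * (64 * C * l / α) := by ring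
    _ ≤ n * Real.exp (-l ^ 2 / 2 - 2 * l) * Real.exp (-(2 * l))
        * (ε * (c₀ / 2) * Real.exp (2 * l)) := by gcongr
    _ = ε * (n * (c₀ * Real.exp (-l ^ 2 / 2 - 2 * l) / 2)) := by
        linear_combination (n * Real.exp (-l ^ 2 / 2 - 2 * l) * ε * (c₀ / 2)) * hE2
    _ ≤ _ := by
        gcongr
        refine le_trans ?_ h4
        gcongr
        exact hc l hl0.le

/-- The noise passing a threshold above the step-up level is asymptotically negligible. -/
lemma eventually_integral_noise_le
    (hX : ∀ n i, HasLaw (X n i) (gaussianReal (θ n i) 1) (P n))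
    (hindep : ∀ n, iIndepFun (X n) (P n)) {α : ℝ} (hα0 : 0 < α) (hα1 : α < 1) {δ : ℕ → ℝ}
    (hδ0 : ∀ n, 0 ≤ δ n) (hδ : Tendsto δ atTop (𝓝 0))
    (hlam : ∀ n, 1 ≤ n → ∀ᵐ ω ∂(P n),
      Real.sqrt (1 + δ n) * xiHatUp α (fun i => X n i ω) ≤ lam n ω)
    (hLt : Tendsto L atTop atTop)
    (hlower : (fun n : ℕ => L0 (δ n) n / (n : ℝ) ^ (δ n))
      =o[atTop] fun n => ∑ i, coordRisk (L n) (θ n i))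
    (hupper : (fun n => ∑ i, coordRisk (L n) (θ n i)) =o[atTop] fun n : ℕ => (n : ℝ))
    (hR0 : ∀ n, 0 ≤ ∑ i, coordRisk (L n) (θ n i)) {ρ : ℝ} (hρ : 0 < ρ) :
    ∀ᶠ n in atTop, ∫ ω, ∑ i, soft (lam n ω) (X n i ω - θ n i) ^ 2 ∂(P n)
      ≤ ρ * ∑ i, coordRisk (L n) (θ n i) := by
  set a : ℝ := (1 + α) / 2 with ha
  have ha0 : 0 ≤ a := by rw [ha]; linarith
  have ha1 : a < 1 := by rw [ha]; linarith
  have hαa : 0 < a - α := by rw [ha]; linarith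
  obtain ⟨u, hu0, hκ⟩ := exists_exp_sub_one_mul_lt ha0 ha1
  set κ := u - (Real.exp u - 1) * a with hκdef
  obtain ⟨Cσ, hCσ0, hCσ⟩ := exists_noiseRisk_le_gaussianTail
  obtain ⟨CE, hCE0, hCE⟩ := exists_exceedance_sub_le
  obtain ⟨S, hS0, hS⟩ := exists_sum_Ioc_mul_exp_le hκ
  -- Chosen so that `m ≥ C₀ w` turns `exp (-κ m / 2)` into at most `exp (-2 w)`.
  set C₀ : ℝ := 4 / κ with hC₀
  have hC₀0 : 0 < C₀ := by positivity
  obtain ⟨CL, hCL0, hCL⟩ := exists_eventually_noiseRisk_le_L0 hα0 hα1 hδ0 hδ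
    (show 0 < 2 * C₀ by positivity)
  set τ : ℝ := ρ * (a - α) / (4 * Cσ) with hτ
  have hτ0 : 0 < τ := by positivity
  obtain ⟨T, B, hTB⟩ := exists_exceedance_sub_le_small hτ0
  have hQT := gaussianTail_pos T
  set D := CL + Cσ * Real.exp u * S with hD
  have hD0 : 0 < D := by positivity
  have hlog := tendsto_log_natCast
  have hM2 : ∀ᶠ n in atTop, truncatedSignal (θ n) (L n) ≤ 2 * ∑ i, coordRisk (L n) (θ n i) := by
    filter_upwards [eventually_truncatedSignal_le (θ := θ) hLt (half_pos one_pos)] with n hn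
    linarith
  have hMn : ∀ b : ℝ, 0 < b → ∀ᶠ n : ℕ in atTop, truncatedSignal (θ n) (L n) ≤ b * n := by
    intro b hb
    filter_upwards [hM2, hupper.bound (half_pos hb)] with n h1 h2
    rw [Real.norm_of_nonneg (hR0 n), Real.norm_of_nonneg (Nat.cast_nonneg n)] at h2
    linarith
  filter_upwards [hCL, hM2, hMn ((a - α) * (2 * gaussianTail T / α) / CE) (by positivity),
    hMn ((a - α) / (2 * τ)) (by positivity), hδ.eventually_le_const one_pos,
    eventually_exp_neg_le_L0 hδ0, hlower.bound (show 0 < ρ / (2 * D) by positivity),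
    hlog.eventually_ge_atTop 1,
    (Real.tendsto_log_atTop.comp hlog).eventually_ge_atTop (1 / C₀),
    hlog.eventually (eventually_mul_pow_le_exp (2 * (2 * C₀)) 1 one_pos),
    hLt.eventually_ge_atTop 1, hLt.eventually_ge_atTop B, eventually_ge_atTop 2] with
    n h1 h2 h3 h4 hd1 hL0 hlow hl1 hll hlin hL1 hLB hn
  have hn1 : 1 ≤ n := by omega
  have hn0 : (0 : ℝ) < n := by exact_mod_cast hn1
  have hn2 : (2 : ℝ) ≤ n := by exact_mod_cast hn
  simp only [Function.comp_apply] at hll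
  rw [one_mul, Real.exp_log hn0, pow_one] at hlin
  have hd0 := hδ0 n
  set R := ∑ i, coordRisk (L n) (θ n i) with hR
  set M := truncatedSignal (θ n) (L n) with hM
  have hM0 : 0 ≤ M := truncatedSignal_nonneg _ _
  set w := δ n * Real.log n + Real.log (Real.log n) with hw
  set Λ := L0 (δ n) n / (n : ℝ) ^ (δ n) with hΛ
  have hll1 : Real.log (Real.log n) ≤ Real.log n - 1 :=
    Real.log_le_sub_one_of_pos (by linarith)
  have hw1 : 1 ≤ C₀ * w := by
    have h5 : 1 / C₀ ≤ w := hll.trans (le_add_of_nonneg_left (by positivity))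
    rwa [div_le_iff₀' hC₀0] at h5
  have hwn : C₀ * w ≤ n / 2 := by
    have h5 : δ n * Real.log n ≤ 1 * Real.log n := by gcongr
    have h6 : C₀ * w ≤ C₀ * (2 * Real.log n) := by gcongr; linarith
    linarith
  set y := τ / (a - α) * M with hy
  have hyn : y ≤ n / 2 := by
    rw [div_mul_eq_mul_div, le_div_iff₀ (by positivity)] at h4
    rw [hy, div_mul_eq_mul_div, div_le_iff₀ hαa]
    linarith
  -- The first term makes the sum beyond `m` negligible; the second absorbs the exceedances due to
  -- signals.
  set m := ⌈max (C₀ * w) y⌉₊ with hm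
  have hmle : (m : ℝ) ≤ 2 * max (C₀ * w) y := by
    have h5 := Nat.ceil_lt_add_one (show 0 ≤ max (C₀ * w) y by
      exact le_max_of_le_left (by linarith))
    have h6 : 1 ≤ max (C₀ * w) y := le_max_of_le_left hw1
    linarith
  have hwm : C₀ * w ≤ m := (le_max_left _ _).trans (Nat.le_ceil _)
  have hym : y ≤ m := (le_max_right _ _).trans (Nat.le_ceil _)
  have hm1 : 1 ≤ m := by
    have : (1 : ℝ) ≤ m := hw1.trans hwm
    exact_mod_cast this
  have hmn : m ≤ n := Nat.ceil_le.2 (max_le (by linarith) (by linarith))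
  have hc1 : 1 ≤ Real.sqrt (1 + δ n) := Real.one_le_sqrt.2 (by linarith)
  have hαk : ∀ k : ℕ, k ≤ n → α * k < 2 * n := fun k hk => by
    have : (k : ℝ) ≤ n := by exact_mod_cast hk
    have hk0 : (0 : ℝ) ≤ k := Nat.cast_nonneg k
    nlinarith
  have hmean : ∀ k, m < k → k ≤ n → meanCount (θ n) (xi α n k) ≤ a * k := fun k hmk hkn =>
    meanCount_xi_le_mul (θ n) hα0 hα1 (by linarith) hCE0 (fun _ _ ht => hTB _ _ _ ht hLB)
      (fun _ _ => hCE _ _ _ hL1) hym h3 hmk hkn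
  have hmain := integral_sum_soft_noise_sq_le (hX n) (hindep n) hα0 hα1 hc1 (hlam n hn1) hm1 hmn
    hu0.le hCσ0.le hCσ hmean
  refine hmain.trans ?_
  rw [← hκdef]
  have hRn : 0 ≤ R := hR0 n
  rw [Real.norm_of_nonneg hL0.1.le, Real.norm_of_nonneg hRn] at hlow
  clear_value a κ C₀ τ D R M w Λ y m
  have hsum : C₀ * w * (κ / 2) = 2 * w := by rw [hC₀]; field_simp; ring
  have htail : ∑ k ∈ Finset.Ioc m n, (k : ℝ) * Real.exp (-κ * k) ≤ S * Λ := by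
    refine (hS m n).trans ?_
    gcongr
    refine le_trans (Real.exp_le_exp.2 ?_) hL0.2
    have : C₀ * w * (κ / 2) ≤ m * (κ / 2) := by gcongr
    linarith
  have hΛR : D * Λ ≤ ρ / 2 * R := by
    calc D * Λ ≤ D * (ρ / (2 * D) * R) := by gcongr
      _ = _ := by field_simp
  have hnoise : n * noiseRisk (Real.sqrt (1 + δ n) * xi α n m) ≤ CL * Λ + ρ / 2 * R := by
    have hx0 := xi_nonneg hα0 hα1 hm1 hmn
    have hΛ0 := hL0.1
    -- If `w` determines `m`, the noise is measured by `L0`. Otherwise `m ≤ 2 y`, and the choice of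
    -- `τ` makes it a small multiple of `M`.
    rcases le_total y (C₀ * w) with hyw | hyw
    · rw [max_eq_left hyw] at hmle
      have h5 := h1 m hm1 (by linarith)
      have h6 : 0 ≤ ρ / 2 * R := mul_nonneg (by positivity) hRn
      linarith
    · rw [max_eq_right hyw] at hmle
      have hxl : xi α n m ≤ Real.sqrt (1 + δ n) * xi α n m := le_mul_of_one_le_left hx0 hc1
      have h5 : noiseRisk (Real.sqrt (1 + δ n) * xi α n m) ≤ Cσ * (α * m / (2 * n)) := by
        rw [← gaussianTail_xi hα0 hm1 hn1 (hαk m hmn)]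
        refine (hCσ _ (hx0.trans hxl)).trans ?_
        gcongr
        exact gaussianTail_antitone hxl
      have hm0 : (0 : ℝ) ≤ m := Nat.cast_nonneg m
      calc n * noiseRisk (Real.sqrt (1 + δ n) * xi α n m)
          ≤ n * (Cσ * (α * m / (2 * n))) := by gcongr
        _ = α * (Cσ * (m / 2)) := by field_simp
        _ ≤ 1 * (Cσ * (2 * y / 2)) := by gcongr
        _ = ρ / 4 * M := by rw [hy, hτ]; field_simp
        _ ≤ ρ / 4 * (2 * R) := by gcongr
        _ ≤ _ := by
            have : 0 ≤ CL * Λ := by positivity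
            linarith
  have h9 : Cσ * Real.exp u * ∑ k ∈ Finset.Ioc m n, (k : ℝ) * Real.exp (-κ * k)
      ≤ Cσ * Real.exp u * (S * Λ) := by gcongr
  calc _ ≤ CL * Λ + ρ / 2 * R + Cσ * Real.exp u * (S * Λ) := add_le_add hnoise h9
    _ = D * Λ + ρ / 2 * R := by rw [hD]; ring
    _ ≤ _ := by linarith

end Asymptotics

/-! ### The minimal risk and the oracle comparison -/

section MinRisk

variable {n : ℕ} {Ω : Type*} [MeasurableSpace Ω] {P : Measure Ω} {θ : Fin n → ℝ}
  {X : Fin n → Ω → ℝ}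

lemma risk_nonneg (l : Ω → ℝ) : 0 ≤ risk P X θ l :=
  integral_nonneg fun _ => Finset.sum_nonneg fun _ _ => sq_nonneg _

lemma minRisk_nonneg : 0 ≤ minRisk P X θ := Real.iInf_nonneg fun _ => risk_nonneg _

lemma minRisk_le_risk {l : ℝ} (hl : 0 ≤ l) : minRisk P X θ ≤ risk P X θ fun _ => l :=
  ciInf_le (f := fun l : Set.Ici (0 : ℝ) => risk P X θ fun _ => (l : ℝ))
    ⟨0, by rintro _ ⟨l, rfl⟩; exact risk_nonneg _⟩ ⟨l, hl⟩

lemma exists_risk_le (h : 0 < minRisk P X θ) {b : ℝ} (hb : 1 < b) :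
    ∃ l : ℝ, 0 ≤ l ∧ risk P X θ (fun _ => l) ≤ b * minRisk P X θ := by
  obtain ⟨l, hl⟩ := exists_lt_of_ciInf_lt
    (show minRisk P X θ < b * minRisk P X θ from lt_mul_of_one_lt_left h hb)
  exact ⟨l, l.2, hl.le⟩

end MinRisk

variable {Ω : ℕ → Type*} [∀ n, MeasurableSpace (Ω n)]
  {P : ∀ n, Measure (Ω n)} [∀ n, IsProbabilityMeasure (P n)]
  {θ : ∀ n, Fin n → ℝ} {X : ∀ n, Fin n → Ω n → ℝ} {lam : ∀ n, Ω n → ℝ}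

/-- The relative excess risk bound resulting from slack `ε` in each step. -/
noncomputable def excessFactor (ε : ℝ) : ℝ :=
  (1 + ε) * ((1 + ε) * ((1 + ε) ^ 2 * (1 + 2 * ε) + ε) + 2 * ε * (2 + 2 * ε))

lemma eventually_risk_le
    (hX : ∀ n i, HasLaw (X n i) (gaussianReal (θ n i) 1) (P n))
    (hindep : ∀ n, iIndepFun (X n) (P n))
    {α₁ α₂ : ℝ} (hα₂ : 0 < α₂) (hα : α₂ ≤ α₁) (hα₁ : α₁ < 1)
    {δ₁ δ₂ : ℕ → ℝ} (hδ₁ : ∀ n, 0 ≤ δ₁ n) (hδ : ∀ n, δ₁ n ≤ δ₂ n)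
    (hδ₂ : Tendsto δ₂ atTop (𝓝 0))
    (hlam_meas : ∀ n, AEMeasurable (lam n) (P n)) (hlam0 : ∀ n, 1 ≤ n → ∀ᵐ ω ∂(P n), 0 ≤ lam n ω)
    (hlam : ∀ n, 1 ≤ n → ∀ᵐ ω ∂(P n),
      Real.sqrt (1 + δ₁ n) * xiHatUp α₁ (fun i => X n i ω) ≤ lam n ω ∧
      lam n ω ≤ Real.sqrt (1 + δ₂ n) * xiHatDown α₂ (fun i => X n i ω))
    (hlower : (fun n : ℕ => L0 (δ₁ n) n / (n : ℝ) ^ (δ₁ n))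
      =o[atTop] (fun n => minRisk (P n) (X n) (θ n)))
    (hupper : (fun n => minRisk (P n) (X n) (θ n)) =o[atTop] (fun n : ℕ => (n : ℝ)))
    {ε : ℝ} (hε : 0 < ε) (hε2 : ε ≤ 1 / 2) :
    ∀ᶠ n in atTop, 0 < minRisk (P n) (X n) (θ n) ∧
      risk (P n) (X n) (θ n) (lam n) ≤ excessFactor ε * minRisk (P n) (X n) (θ n) := by
  -- An eventually positive sequence is negligible against the minimal risk, which therefore cannot
  -- vanish for large `n`.
  have hη : ∀ᶠ n in atTop, 0 < minRisk (P n) (X n) (θ n) := by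
    filter_upwards [eventually_exp_neg_le_L0 hδ₁, hlower.bound one_pos] with n h1 h2
    refine lt_of_le_of_ne minRisk_nonneg fun h => ?_
    rw [← h, norm_zero, mul_zero, norm_le_zero_iff] at h2
    exact h1.1.ne' h2
  have hex : ∀ n, ∃ l : ℝ, 0 ≤ l ∧ (0 < minRisk (P n) (X n) (θ n) →
      risk (P n) (X n) (θ n) (fun _ => l) ≤ (1 + ε) * minRisk (P n) (X n) (θ n)) := fun n => by
    by_cases h : 0 < minRisk (P n) (X n) (θ n)
    · obtain ⟨l, hl0, hl⟩ := exists_risk_le h (show 1 < 1 + ε by linarith)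
      exact ⟨l, hl0, fun _ => hl⟩
    · exact ⟨0, le_rfl, fun h' => absurd h' h⟩
  choose L hL0 hL using hex
  have hrisk : ∀ n, risk (P n) (X n) (θ n) (fun _ => L n) = ∑ i, coordRisk (L n) (θ n i) :=
    fun n => risk_const (hX n) (hL0 n)
  have hR0 : ∀ n, 0 ≤ ∑ i, coordRisk (L n) (θ n i) := fun n => by
    rw [← hrisk]; exact risk_nonneg _
  have hle : ∀ n, minRisk (P n) (X n) (θ n) ≤ ∑ i, coordRisk (L n) (θ n i) := fun n => by
    rw [← hrisk]; exact minRisk_le_risk (hL0 n)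
  have hge : ∀ᶠ n in atTop,
      ∑ i, coordRisk (L n) (θ n i) ≤ (1 + ε) * minRisk (P n) (X n) (θ n) := by
    filter_upwards [hη] with n hn
    rw [← hrisk]
    exact hL n hn
  have hlowerR : (fun n : ℕ => L0 (δ₁ n) n / (n : ℝ) ^ (δ₁ n))
      =o[atTop] fun n => ∑ i, coordRisk (L n) (θ n i) :=
    hlower.trans_isBigO (isBigO_of_le _ fun n => by
      rw [Real.norm_of_nonneg minRisk_nonneg, Real.norm_of_nonneg (hR0 n)]
      exact hle n)
  have hupperR : (fun n => ∑ i, coordRisk (L n) (θ n i)) =o[atTop] fun n : ℕ => (n : ℝ) := by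
    refine IsBigO.trans_isLittleO (IsBigO.of_bound (1 + ε) ?_) hupper
    filter_upwards [hge] with n hn
    rwa [Real.norm_of_nonneg minRisk_nonneg, Real.norm_of_nonneg (hR0 n)]
  have hLt : Tendsto L atTop atTop := tendsto_level hL0 hupperR
  have hδ₁t : Tendsto δ₁ atTop (𝓝 0) :=
    tendsto_of_tendsto_of_tendsto_of_le_of_le tendsto_const_nhds hδ₂ hδ₁ hδ
  have hα₂1 : α₂ < 1 := hα.trans_lt hα₁
  have hα₁0 : 0 < α₁ := hα₂.trans_le hα
  have hbias := eventually_integral_truncatedSignal_le hX hindep hα₂ hα₂1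
    (fun n => (hδ₁ n).trans (hδ n)) hδ₂ hlam_meas
    (fun n hn => (hlam n hn).mono fun ω h => h.2) hLt hε (by linarith)
  have hnoise := eventually_integral_noise_le hX hindep hα₁0 hα₁ hδ₁ hδ₁t
    (fun n hn => (hlam n hn).mono fun ω h => h.1) hLt hlowerR hupperR hR0
    (show 0 < ε ^ 2 by positivity)
  filter_upwards [hη, hge, hbias, hnoise, eventually_truncatedSignal_le (θ := θ) hLt hε,
    hLt.eventually_ge_atTop (1 / ε), eventually_ge_atTop 1] with n h1 h2 h3 h4 h5 hLε hn
  refine ⟨h1, ?_⟩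
  have hLn := hL0 n
  have hLle : L n ≤ (1 + ε) * L n := le_mul_of_one_le_left hLn (by linarith)
  have h6 := risk_le (hX n) (hlam_meas n) (hlam0 n hn) hε (hLε.trans hLle) (hLn.trans hLle)
  have h7 := card_le_truncatedSignal (θ n) (show 0 ≤ 1 / ε by positivity) hLε
  have hM0 := truncatedSignal_nonneg (θ n) (L n)
  have hRn := hR0 n
  generalize truncatedSignal (θ n) (L n) = M at *
  generalize ∑ i, coordRisk (L n) (θ n i) = R at *
  generalize minRisk (P n) (X n) (θ n) = η at *
  have h8 : M ≤ (1 + 2 * ε) * R := by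
    have h11 : (1 + 2 * ε) * ((1 - ε) * M) ≤ (1 + 2 * ε) * R := by gcongr
    have h12 : 0 ≤ ε * (1 - 2 * ε) * M := mul_nonneg (mul_nonneg hε.le (by linarith)) hM0
    linarith
  have h9 : ((Finset.univ.filter fun i => 1 / ε ≤ |θ n i|).card : ℝ) ≤ ε ^ 2 * M := by
    rw [div_pow, one_pow, mul_one_div, div_le_iff₀ (by positivity)] at h7
    linarith
  -- Noise and large signals are each of relative size `ε²`, so the Young constant `1 + 1 / ε` is
  -- harmless.
  have h10 : (1 + 1 / ε) * ε ^ 2 ≤ 2 * ε := by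
    have : (1 + 1 / ε) * ε ^ 2 = ε ^ 2 + ε := by field_simp
    nlinarith
  calc risk (P n) (X n) (θ n) (lam n)
      ≤ (1 + ε) * ((1 + ε) ^ 2 * M + ε * R) + (1 + 1 / ε) * (ε ^ 2 * R + ε ^ 2 * M) := by
        refine h6.trans ?_
        gcongr
    _ = (1 + ε) * ((1 + ε) ^ 2 * M + ε * R) + (1 + 1 / ε) * ε ^ 2 * (R + M) := by ring
    _ ≤ (1 + ε) * ((1 + ε) ^ 2 * ((1 + 2 * ε) * R) + ε * R)
        + 2 * ε * (R + (1 + 2 * ε) * R) := by gcongr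
    _ = ((1 + ε) * ((1 + ε) ^ 2 * (1 + 2 * ε) + ε) + 2 * ε * (2 + 2 * ε)) * R := by ring
    _ ≤ ((1 + ε) * ((1 + ε) ^ 2 * (1 + 2 * ε) + ε) + 2 * ε * (2 + 2 * ε)) * ((1 + ε) * η) := by
        gcongr
    _ = _ := by rw [excessFactor]; ring

lemma exists_excessFactor_le {b : ℝ} (hb : 1 < b) :
    ∃ ε : ℝ, 0 < ε ∧ ε ≤ 1 / 2 ∧ excessFactor ε ≤ b := by
  have hc : Continuous excessFactor := by unfold excessFactor; fun_prop
  have h0 : Tendsto excessFactor (𝓝[>] 0) (𝓝 1) := by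
    have h := (hc.tendsto 0).mono_left (nhdsWithin_le_nhds (s := Set.Ioi 0))
    simpa [excessFactor] using h
  have h1 : ∀ᶠ ε : ℝ in 𝓝[>] 0, ε ∈ Set.Ioc (0 : ℝ) (1 / 2) :=
    Ioc_mem_nhdsGT (by norm_num)
  obtain ⟨ε, h2, h3⟩ := ((h0.eventually_le_const hb).and h1).exists
  exact ⟨ε, h3.1, h3.2, h2⟩

end FDR

theorem theorem1
    {Ω : ℕ → Type*} [∀ n, MeasurableSpace (Ω n)]
    (P : ∀ n, Measure (Ω n)) [∀ n, IsProbabilityMeasure (P n)]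
    (θ : ∀ n, Fin n → ℝ) (X : ∀ n, Fin n → Ω n → ℝ)
    (hX : ∀ n i, HasLaw (X n i) (gaussianReal (θ n i) 1) (P n))
    (hindep : ∀ n, iIndepFun (X n) (P n))
    (α₁ α₂ : ℝ) (hα₂ : 0 < α₂) (hα : α₂ ≤ α₁) (hα₁ : α₁ < 1)
    (δ₁ δ₂ : ℕ → ℝ) (hδ₁ : ∀ n, 0 ≤ δ₁ n) (hδ : ∀ n, δ₁ n ≤ δ₂ n)
    (hδ₂ : Tendsto δ₂ atTop (𝓝 0))
    (lam : ∀ n, Ω n → ℝ) (hlam_meas : ∀ n, AEMeasurable (lam n) (P n))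
    (hlam : ∀ n, 1 ≤ n → ∀ᵐ ω ∂(P n),
      Real.sqrt (1 + δ₁ n) * FDR.xiHatUp α₁ (fun i => X n i ω) ≤ lam n ω ∧
      lam n ω ≤ Real.sqrt (1 + δ₂ n) * FDR.xiHatDown α₂ (fun i => X n i ω))
    (hlower : (fun n : ℕ => FDR.L0 (δ₁ n) n / (n : ℝ) ^ (δ₁ n))
      =o[atTop] (fun n => FDR.minRisk (P n) (X n) (θ n)))
    (hupper : (fun n => FDR.minRisk (P n) (X n) (θ n)) =o[atTop] (fun n : ℕ => (n : ℝ))) :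
    (∀ n, 1 ≤ n →
      Integrable (fun ω => FDR.loss (θ n) (lam n ω) (fun i => X n i ω)) (P n)) ∧
    limsup (fun n =>
      ((FDR.risk (P n) (X n) (θ n) (lam n) / FDR.minRisk (P n) (X n) (θ n) : ℝ) : EReal)) atTop
      ≤ 1 := by
  have hlam0 : ∀ n, 1 ≤ n → ∀ᵐ ω ∂(P n), 0 ≤ lam n ω := fun n hn =>
    (hlam n hn).mono fun ω h => le_trans (mul_nonneg (Real.sqrt_nonneg _)
      (FDR.xiHatUp_nonneg (hα₂.trans_le hα) hα₁ hn _)) h.1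
  refine ⟨fun n hn => FDR.integrable_loss (hX n) (hlam_meas n) (hlam0 n hn), ?_⟩
  refine EReal.le_of_forall_lt_iff_le.1 fun b hb => ?_
  have hb1 : 1 < b := by exact_mod_cast hb
  obtain ⟨ε, hε, hε2, hεb⟩ := FDR.exists_excessFactor_le hb1
  refine limsup_le_of_le (by isBoundedDefault) ?_
  filter_upwards [FDR.eventually_risk_le hX hindep hα₂ hα hα₁ hδ₁ hδ hδ₂ hlam_meas hlam0 hlam
    hlower hupper hε hε2] with n h
  rw [EReal.coe_le_coe_iff, div_le_iff₀ h.1]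
  exact h.2.trans (mul_le_mul_of_nonneg_right hεb h.1.le)
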